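/- **Setting.** All matrices are real. $\|\cdot\|_F$ is the Frobenius norm, $\|\cdot\|_2$ the Euclidean/spectral norm, $\sigma_j$ the $j$-th largest singular value, $\sigma_{\min}$ the smallest one, $\operatorname{cond}=\sigma_{\max}/\sigma_{\min}$. Floating-point arithmetic with unit roundoff $u$ follows the standard model: the computed result of an operation with exact result $x$ is $x(1+\varepsilon)$ for some $|\varepsilon|\le u$. A matrix $S\in\mathbb R^{d\times m}$ is a $\delta$-embedding for a subspace $L\subseteq\mathbb R^m$, $\delta\in[0,1]$, if for a matrix $U$ whose columns form an orthonormal basis of $L$ all singular values of $SU$ lie in $[1-\delta,1+\delta]$. Let $M\in\mathbb R^{m\times n}$, $S\in\mathbb R^{d\times m}$, let $J$ be a permutation of the columns, $M_n=M[:,J]$, $1\le k\le\min(n,r)$, $M_k=M[:,J[1..k]]$. Let $\hat M^{sk}\in\mathbb R^{d\times n}$ (computed sketch, $\approx SM$), $\hat Q\in\mathbb R^{d\times r}$ and upper triangular $\hat R\in\mathbb R^{r\times n}$ (computed pivoted QR factors of $\hat M^{sk}$), and write $\hat A_k=\hat R[1..k,1..k]$, $\hat B_k=\hat R[1..k,k{+}1..n]$,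 $\hat C_\ell=\hat R[\ell{+}1..r,\ell{+}1..n]$, $\hat R_k=\hat R[1..k,:]$. Let $0<u\le 0.001\,n^{-3/2}k^{-5/2}$ and assume: 1. (QR accuracy) with $E_2=\hat M^{sk}[:,J]-\hat Q\hat R$: $\|E_2[:,j]\|_2\le 0.01k^{-1/2}u\,\|\hat M^{sk}[:,J][:,j]\|_2$ for $1\le j\le n$, and $\|\hat Q^*\hat Q-I\|_F\le 0.1u$; 2. (rank-revealing property) $\sigma_{\min}(\hat A_k)\ge \tfrac12 n^{-1/2}k^{-1/2}\sigma_k(\hat M^{sk})$, $\|\hat C_{k-1}\|_2\le 2n^{1/2}k^{1/2}\sigma_k(\hat M^{sk})$, $\|\hat A_k^{-1}\hat B_k\|_F\le 2n^{1/2}k^{1/2}$; 3. (choice of $k$) $1000\,n^{3/2}k^{5/2}u\le \|\hat C_{k-1}\|_F/\|\hat R\|_2$; 4. (preconditioning) $\hat M^{pre}_k\in\mathbb R^{m\times k}$ is computed from $M_k$ and $\hat A_k$ by triangular substitution with unit roundoff $u$ in the standard model, column after column, $\hat M^{pre}_k[:,j]=\bigl(M_k[:,j]-\sum_{l<j}\hat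 M^{pre}_k[:,l]\,\hat A_k[l,j]\bigr)/\hat A_k[j,j]$, the terms being accumulated in any order that is the same for all rows. Let $t\ne0$ be a scalar such that $tS$ is a $\delta$-embedding for $\operatorname{range}(M)$ with $\delta\le\frac14$. **Claim (a).** Suppose the sketch is accurate relative to $tS$: the $j$-th column of $tSM_n-t\hat M^{sk}[:,J]$ has Euclidean norm at most $0.01k^{-1/2}u\|M_n[:,j]\|_2$ for $j\le k$ and at most $0.1n^{-1/2}u\|M_n[:,j]\|_2$ for $j>k$. Then $$\frac{\|M_n-\hat M^{pre}_k\hat R_k\|_F}{\|M\|_F}\le 2\,\frac{\|\hat C_k\|_F}{\|\hat R\|_2}+10nku\qquad\text{and}\qquad \operatorname{cond}(\hat M^{pre}_k)\le1.8,$$ where $\hat M^{pre}_k$ has full column rank. **Claim (b).** For every constant $c$ there is a polynomial $F$ of degree at most $1$, positive on $[1,\infty)$ and depending on $c$ only, such that the same conclusions hold, without the accuracy assumption of (a), whenever $|t|\,\|S\|_F\le c\sqrt m$ and $\hat M^{sk}$ is computed as the product $SM$ in the standard model (any order of summation) with a unit roundoff $0\le\tilde u\le m^{-3/2}F(n)^{-1}u$.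 -/

import Mathlib

open Matrix Polynomial

noncomputable section

namespace CQRRPT

/-! ### Norms and singular values -/

/-- Euclidean length of a vector. -/
def vecNorm {ι : Type} [Fintype ι] (v : ι → ℝ) : ℝ := ‖(WithLp.toLp 2 v : EuclideanSpace ℝ ι)‖

/-- Frobenius norm. -/
def frobNorm {ι κ : Type} [Fintype ι] [Fintype κ] (X : Matrix ι κ ℝ) : ℝ :=
  √(∑ i, ∑ j, X i j ^ 2)

/-- `sigma X j` is the `j`-th largest singular value of `X`, where `j = 1, 2, …`. -/
def sigma {ι κ : Type} [Fintype ι] [Fintype κ] [DecidableEq κ] (X : Matrix ι κ ℝ) (j : ℕ) : ℝ :=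
  (toEuclideanLin X).singularValues (j - 1)

/-- Spectral norm, i.e. the operator norm for the Euclidean norms. -/
def specNorm {ι κ : Type} [Fintype ι] [Fintype κ] [DecidableEq κ] (X : Matrix ι κ ℝ) : ℝ :=
  ‖(toEuclideanLin X).toContinuousLinearMap‖

/-- The smallest singular value of a matrix with at least as many rows as columns (it is `0` exactly
when the columns are linearly dependent). -/
def sigmaMin {ι : Type} [Fintype ι] {k : ℕ} (X : Matrix ι (Fin k) ℝ) : ℝ := sigma X k

/-- The condition number `σ_max / σ_min`; meaningful only if `0 < sigmaMin X`. -/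
def cond {ι : Type} [Fintype ι] {k : ℕ} (X : Matrix ι (Fin k) ℝ) : ℝ := sigma X 1 / sigmaMin X

/-! ### Subspace embeddings -/

/-- `S` is a `δ`-embedding for the subspace `L`: for a matrix `U` whose columns are an orthonormal
basis of `L`, all singular values of `S * U` lie in `[1 - δ, 1 + δ]`. -/
def IsEmbedding {m d : ℕ} (δ : ℝ) (S : Matrix (Fin d) (Fin m) ℝ)
    (L : Submodule ℝ (Fin m → ℝ)) : Prop :=
  0 ≤ δ ∧ δ ≤ 1 ∧ ∃ (p : ℕ) (U : Matrix (Fin m) (Fin p) ℝ),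
    Uᵀ * U = 1 ∧ LinearMap.range U.mulVecLin = L ∧
      ∀ j, 1 ≤ j → j ≤ p → 1 - δ ≤ sigma (S * U) j ∧ sigma (S * U) j ≤ 1 + δ

/-! ### Blocks of matrices -/

/-- The matrix `X[:, J]` with permuted columns. -/
def permCols {ι : Type} {n : ℕ} (X : Matrix ι (Fin n) ℝ) (J : Equiv.Perm (Fin n)) :
    Matrix ι (Fin n) ℝ := X.submatrix id J

/-- The first `k` columns. -/
def firstCols {ι : Type} {n k : ℕ} (hk : k ≤ n) (X : Matrix ι (Fin n) ℝ) :
    Matrix ι (Fin k) ℝ := X.submatrix id (Fin.castLE hk)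

/-- The first `k` rows. -/
def firstRows {κ : Type} {r k : ℕ} (hk : k ≤ r) (R : Matrix (Fin r) κ ℝ) :
    Matrix (Fin k) κ ℝ := R.submatrix (Fin.castLE hk) id

/-- The block `A_k = R[1..k, 1..k]`. -/
def blockA {r n k : ℕ} (hr : k ≤ r) (hn : k ≤ n) (R : Matrix (Fin r) (Fin n) ℝ) :
    Matrix (Fin k) (Fin k) ℝ := R.submatrix (Fin.castLE hr) (Fin.castLE hn)

/-- The block `B_k = R[1..k, k+1..n]`. -/
def blockB {r n k : ℕ} (hr : k ≤ r) (R : Matrix (Fin r) (Fin n) ℝ) :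
    Matrix (Fin k) {j : Fin n // k ≤ (j : ℕ)} ℝ := R.submatrix (Fin.castLE hr) Subtype.val

/-- The block `C_l = R[l+1..r, l+1..n]`. -/
def blockC {r n : ℕ} (R : Matrix (Fin r) (Fin n) ℝ) (l : ℕ) :
    Matrix {i : Fin r // l ≤ (i : ℕ)} {j : Fin n // l ≤ (j : ℕ)} ℝ :=
  R.submatrix Subtype.val Subtype.val

/-! ### Floating-point arithmetic: the standard model -/

/-- `y` is an admissible result of a floating-point operation whose exact result is `x`, for the
unit roundoff `u`. -/
def Rounds (u x y : ℝ) : Prop := ∃ ε : ℝ, |ε| ≤ u ∧ y = x * (1 + ε)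

/-- An order of evaluation of a sum: a full binary tree with labelled leaves. -/
inductive SumTree (ι : Type) : Type
  | leaf : ι → SumTree ι
  | add : SumTree ι → SumTree ι → SumTree ι

/-- The labels of the leaves, with multiplicity. -/
def SumTree.leaves {ι : Type} : SumTree ι → Multiset ι
  | .leaf i => {i}
  | .add a b => a.leaves + b.leaves

/-- `s` is an admissible value of the sum of the numbers `x i` at the leaves, each addition being
rounded with unit roundoff `u`. -/
def SumTree.Evaluates {ι : Type} (u : ℝ) (x : ι → ℝ) : SumTree ι → ℝ → Prop
  | .leaf i, s => s = x i
  | .add a b, s => ∃ sa sb : ℝ, a.Evaluates u x sa ∧ b.Evaluates u x sb ∧ Rounds u (sa + sb) s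

/-- `Y` is an admissible result of computing the product `S * M` with unit roundoff `u`: every entry
is a sum of rounded products, accumulated in some order. -/
def FlMul {m n d : ℕ} (u : ℝ) (S : Matrix (Fin d) (Fin m) ℝ) (M : Matrix (Fin m) (Fin n) ℝ)
    (Y : Matrix (Fin d) (Fin n) ℝ) : Prop :=
  ∀ i j, ∃ (T : SumTree (Fin m)) (q : Fin m → ℝ),
    T.leaves = Finset.univ.val ∧ (∀ l, Rounds u (S i l * M l j) (q l)) ∧ T.Evaluates u q (Y i j)

/-- `P` is an admissible result of computing `X * A⁻¹` (`A` upper triangular) by substitution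
(TRSM) with unit roundoff `u`: column after column,
`P[:, j] = (X[:, j] - ∑_{l < j} P[:, l] * A[l, j]) / A[j, j]`. The terms may be accumulated in any
order `T` that depends on the column only (the routine works on whole columns). The leaf `none`
carries `X[:, j]` and the leaf `some l` carries the rounded product. -/
def FlTrsm {m k : ℕ} (u : ℝ) (X : Matrix (Fin m) (Fin k) ℝ) (A : Matrix (Fin k) (Fin k) ℝ)
    (P : Matrix (Fin m) (Fin k) ℝ) : Prop :=
  ∀ j : Fin k, ∃ T : SumTree (Option {l : Fin k // l < j}),
    T.leaves = Finset.univ.val ∧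
    ∀ i : Fin m, ∃ (q : {l : Fin k // l < j} → ℝ) (s : ℝ),
      (∀ l, Rounds u (P i l.1 * A l.1 j) (q l)) ∧
      T.Evaluates u (fun o => o.elim (X i j) (fun l => -q l)) s ∧
      Rounds u (s / A j j) (P i j)

/-! ### The computational model for the preconditioner -/

/-- Accuracy of the computed sketch `Y ≈ S * M` with respect to the scaled operator `t • S`
(columns taken in the pivot order). -/
def SketchAccurate {m n d : ℕ} (k : ℕ) (u t : ℝ) (S : Matrix (Fin d) (Fin m) ℝ)
    (M : Matrix (Fin m) (Fin n) ℝ) (Y : Matrix (Fin d) (Fin n) ℝ) (J : Equiv.Perm (Fin n)) :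
    Prop :=
  ∀ j : Fin n,
    ((j : ℕ) < k →
      vecNorm (((t • S) * permCols M J - t • permCols Y J).col j) ≤
        1 / 100 * (k : ℝ) ^ (-(1 / 2) : ℝ) * u * vecNorm ((permCols M J).col j)) ∧
    (k ≤ (j : ℕ) →
      vecNorm (((t • S) * permCols M J - t • permCols Y J).col j) ≤
        1 / 10 * (n : ℝ) ^ (-(1 / 2) : ℝ) * u * vecNorm ((permCols M J).col j))

/-- Accuracy of the computed pivoted QR factorization `Y[:, J] ≈ Q * R` of the computed sketch. -/
structure QrcpAccurate {n d r : ℕ} (k : ℕ) (u : ℝ) (Y : Matrix (Fin d) (Fin n) ℝ)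
    (J : Equiv.Perm (Fin n)) (Q : Matrix (Fin d) (Fin r) ℝ) (R : Matrix (Fin r) (Fin n) ℝ) :
    Prop where
  upper : ∀ (i : Fin r) (j : Fin n), (j : ℕ) < (i : ℕ) → R i j = 0
  residual : ∀ j : Fin n,
    vecNorm ((permCols Y J - Q * R).col j) ≤
      1 / 100 * (k : ℝ) ^ (-(1 / 2) : ℝ) * u * vecNorm ((permCols Y J).col j)
  orth : frobNorm (Qᵀ * Q - 1) ≤ 1 / 10 * u

/-- The strong rank-revealing properties required from the computed R-factor at the index `k`. -/
structure RankRevealing {n d r k : ℕ} (hr : k ≤ r) (hn : k ≤ n) (Y : Matrix (Fin d) (Fin n) ℝ)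
    (R : Matrix (Fin r) (Fin n) ℝ) : Prop where
  sigmaMin_blockA : 1 / 2 * (n : ℝ) ^ (-(1 / 2) : ℝ) * (k : ℝ) ^ (-(1 / 2) : ℝ) * sigma Y k ≤
    sigmaMin (blockA hr hn R)
  specNorm_blockC : specNorm (blockC R (k - 1)) ≤
    2 * (n : ℝ) ^ (1 / 2 : ℝ) * (k : ℝ) ^ (1 / 2 : ℝ) * sigma Y k
  frobNorm_blockB : frobNorm ((blockA hr hn R)⁻¹ * blockB hr R) ≤
    2 * (n : ℝ) ^ (1 / 2 : ℝ) * (k : ℝ) ^ (1 / 2 : ℝ)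

/-- The part of a finite-precision run that follows the sketching step: `Y` is the computed sketch,
`Q, R, J` is its computed pivoted QR factorization, `k` is the truncation index and `P` is the
computed preconditioned matrix, obtained from `M[:, J[1..k]]` and `A_k` with unit roundoff `u`. -/
structure PrecondRun {m n d r k : ℕ} (hr : k ≤ r) (hn : k ≤ n) (u : ℝ)
    (M : Matrix (Fin m) (Fin n) ℝ) (Y : Matrix (Fin d) (Fin n) ℝ) (J : Equiv.Perm (Fin n))
    (Q : Matrix (Fin d) (Fin r) ℝ) (R : Matrix (Fin r) (Fin n) ℝ)
    (P : Matrix (Fin m) (Fin k) ℝ) : Prop where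
  roundoff_pos : 0 < u
  roundoff_le : u ≤ 1 / 1000 * (n : ℝ) ^ (-(3 / 2) : ℝ) * (k : ℝ) ^ (-(5 / 2) : ℝ)
  qrcp : QrcpAccurate k u Y J Q R
  rankRevealing : RankRevealing hr hn Y R
  truncation : 1000 * (n : ℝ) ^ (3 / 2 : ℝ) * (k : ℝ) ^ (5 / 2 : ℝ) * u ≤
    frobNorm (blockC R (k - 1)) / specNorm R
  trsm : FlTrsm u (firstCols hn (permCols M J)) (blockA hr hn R) P

/-- Stability of the preconditioner: the bound on the reconstruction error, and
`cond P ≤ 1.8` (with `P` of full column rank). -/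
def PrecondStable {m n r k : ℕ} (hr : k ≤ r) (u : ℝ)
    (M : Matrix (Fin m) (Fin n) ℝ) (J : Equiv.Perm (Fin n)) (R : Matrix (Fin r) (Fin n) ℝ)
    (P : Matrix (Fin m) (Fin k) ℝ) : Prop :=
  frobNorm (permCols M J - P * firstRows hr R) / frobNorm M ≤
      2 * (frobNorm (blockC R k) / specNorm R) + 10 * n * k * u ∧
    0 < sigmaMin P ∧ cond P ≤ 9 / 5

end CQRRPT

end

noncomputable section

namespace CQRRPT

/-! ### Euclidean length -/

section vecNorm

variable {ι : Type} [Fintype ι]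

/-! On the range of `M` the operator `t • S` changes lengths only by factors in [3/4, 5/4], so sizes
of vectors there may be measured after sketching. Put `X = M[:, J]` and `G = t • S`, and replace
`R`, `P` by `t • R`, `t⁻¹ • P`, which changes neither `P * R_k` nor `A⁻¹ * B`. Then `G * X = Q * R +
E`, where `E` has columns of relative size `u` and `Q` is almost an isometry. Since `R` is
triangular, `|X_k z|` agrees with `|A z|` up to factors close to 4/3 and 4/5, provided `E_k z` is
negligible against `A z`. This is what the choice of `k` ensures: chained with the rank-revealing
bounds it gives `k u ‖A‖_F |z| ≤ |A z| / 250` (`PrecondRun.leading_block`). Hence `X_k A⁻¹` is well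
conditioned.

Substitution yields `P * A = X_k - V`, where column `j` of `V` is at most `1.52 k u ‖P‖₂ |A_j|`
(`FlTrsm.vecNorm_col_le`). By the same bound on `A`, `V A⁻¹` is small, so `P` is well conditioned
too.

The reconstruction error is `V` on the first `k` columns and `W + V Z` on the others, where `Z = A⁻¹
B` and `W = X_rest - X_k Z`. The columns of `W` lie in the range of `X`, and `G W` equals `Q` times
the Schur complement, whose nonzero part is `C_k`, plus terms in `E`. The factor `n` in the bound
comes from `‖Z‖_F ≤ 2 √n √k ≤ 2 n`. These estimates are assembled in `precond_error`.

Claim (b) reduces to (a): the columnwise error of the computed product is about `m u' ‖S‖_F |M_j|`,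
and `|t| ‖S‖_F ≤ c √m` turns this into a multiple of `m^(3/2) u'` (`FlMul.sketchAccurate`). -/

lemma vecNorm_nonneg (v : ι → ℝ) : 0 ≤ vecNorm v := norm_nonneg _

lemma vecNorm_sq (v : ι → ℝ) : vecNorm v ^ 2 = ∑ i, v i ^ 2 := by
  simp [vecNorm, EuclideanSpace.norm_sq_eq]

lemma vecNorm_eq_sqrt (v : ι → ℝ) : vecNorm v = √(∑ i, v i ^ 2) := by
  rw [← vecNorm_sq, Real.sqrt_sq (vecNorm_nonneg v)]

@[simp] lemma vecNorm_zero : vecNorm (0 : ι → ℝ) = 0 := by simp [vecNorm]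

lemma vecNorm_add_le (v w : ι → ℝ) : vecNorm (v + w) ≤ vecNorm v + vecNorm w := by
  simpa [vecNorm] using norm_add_le (WithLp.toLp 2 v) (WithLp.toLp 2 w)

lemma vecNorm_sub_le (v w : ι → ℝ) : vecNorm (v - w) ≤ vecNorm v + vecNorm w := by
  simpa [vecNorm] using norm_sub_le (WithLp.toLp 2 v) (WithLp.toLp 2 w)

lemma vecNorm_neg (v : ι → ℝ) : vecNorm (-v) = vecNorm v := by simp [vecNorm]

lemma vecNorm_smul (c : ℝ) (v : ι → ℝ) : vecNorm (c • v) = |c| * vecNorm v := by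
  simp [vecNorm, norm_smul]

lemma vecNorm_sum_le {τ : Type} (s : Finset τ) (f : τ → ι → ℝ) :
    vecNorm (∑ l ∈ s, f l) ≤ ∑ l ∈ s, vecNorm (f l) := by
  simpa [vecNorm] using norm_sum_le s fun l => (WithLp.toLp 2 (f l) : EuclideanSpace ℝ ι)

lemma vecNorm_le_of_abs_le {v w : ι → ℝ} (h : ∀ i, |v i| ≤ |w i|) : vecNorm v ≤ vecNorm w := by
  rw [vecNorm_eq_sqrt, vecNorm_eq_sqrt]
  exact Real.sqrt_le_sqrt (Finset.sum_le_sum fun i _ => sq_le_sq.2 (h i))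

lemma vecNorm_le_mul_of_abs_le {c : ℝ} (hc : 0 ≤ c) {v w : ι → ℝ} (h : ∀ i, |v i| ≤ c * |w i|) :
    vecNorm v ≤ c * vecNorm w := by
  rw [← abs_of_nonneg hc, ← vecNorm_smul]
  refine vecNorm_le_of_abs_le fun i => ?_
  simpa [abs_mul, abs_of_nonneg hc] using h i

lemma abs_le_vecNorm (v : ι → ℝ) (i : ι) : |v i| ≤ vecNorm v := by
  refine abs_le_of_sq_le_sq ?_ (vecNorm_nonneg v)
  rw [vecNorm_sq]
  exact Finset.single_le_sum (f := fun i => v i ^ 2) (fun i _ => sq_nonneg _) (Finset.mem_univ i)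

lemma vecNorm_eq_zero {v : ι → ℝ} (h : vecNorm v = 0) : v = 0 := by
  ext i
  simpa [h] using abs_le_vecNorm v i

lemma sum_abs_le_sqrt_card_mul_vecNorm (v : ι → ℝ) :
    ∑ i, |v i| ≤ √(Fintype.card ι) * vecNorm v := by
  rw [vecNorm_eq_sqrt, ← Real.sqrt_mul (by positivity)]
  refine Real.le_sqrt_of_sq_le ?_
  simpa using sq_sum_le_card_mul_sum_sq (s := Finset.univ) (f := fun i => |v i|)

lemma abs_dotProduct_le (v w : ι → ℝ) : |v ⬝ᵥ w| ≤ vecNorm v * vecNorm w := by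
  have := abs_real_inner_le_norm (WithLp.toLp 2 v : EuclideanSpace ℝ ι) (WithLp.toLp 2 w)
  rw [EuclideanSpace.inner_toLp_toLp, dotProduct_comm] at this
  simpa [vecNorm] using this

lemma dotProduct_self_eq_vecNorm_sq (v : ι → ℝ) : v ⬝ᵥ v = vecNorm v ^ 2 := by
  rw [vecNorm_sq]
  simp [dotProduct, sq]

end vecNorm

/-! ### Frobenius norm -/

lemma col_mul {ι κ μ : Type} [Fintype κ] (X : Matrix ι κ ℝ) (Y : Matrix κ μ ℝ) (j : μ) :
    (X * Y).col j = X *ᵥ Y.col j := rfl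

section frobNorm

variable {ι κ μ : Type} [Fintype ι] [Fintype κ] [Fintype μ]

lemma frobNorm_nonneg (X : Matrix ι κ ℝ) : 0 ≤ frobNorm X := Real.sqrt_nonneg _

lemma frobNorm_sq (X : Matrix ι κ ℝ) : frobNorm X ^ 2 = ∑ j, vecNorm (X.col j) ^ 2 := by
  rw [frobNorm, Real.sq_sqrt (by positivity), Finset.sum_comm]
  simp [vecNorm_sq]

lemma frobNorm_sq_rows (X : Matrix ι κ ℝ) : frobNorm X ^ 2 = ∑ i, vecNorm (X i) ^ 2 := by
  rw [frobNorm, Real.sq_sqrt (by positivity)]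
  simp [vecNorm_sq]

lemma frobNorm_eq_vecNorm (X : Matrix ι κ ℝ) :
    frobNorm X = vecNorm fun p : ι × κ => X p.1 p.2 := by
  rw [vecNorm_eq_sqrt, frobNorm, Fintype.sum_prod_type]

lemma frobNorm_add_le (X Y : Matrix ι κ ℝ) : frobNorm (X + Y) ≤ frobNorm X + frobNorm Y := by
  simp only [frobNorm_eq_vecNorm]
  exact vecNorm_add_le _ _

lemma frobNorm_sub_le (X Y : Matrix ι κ ℝ) : frobNorm (X - Y) ≤ frobNorm X + frobNorm Y := by
  simp only [frobNorm_eq_vecNorm]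
  exact vecNorm_sub_le _ _

lemma frobNorm_smul (c : ℝ) (X : Matrix ι κ ℝ) : frobNorm (c • X) = |c| * frobNorm X := by
  simp only [frobNorm_eq_vecNorm]
  exact vecNorm_smul _ _

lemma frobNorm_le_of_col_le {c : ℝ} (hc : 0 ≤ c) {ι' : Type} [Fintype ι'] {X : Matrix ι κ ℝ}
    {Y : Matrix ι' κ ℝ} (h : ∀ j, vecNorm (X.col j) ≤ c * vecNorm (Y.col j)) :
    frobNorm X ≤ c * frobNorm Y := by
  refine le_of_sq_le_sq ?_ (mul_nonneg hc (frobNorm_nonneg _))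
  rw [mul_pow, frobNorm_sq, frobNorm_sq, Finset.mul_sum]
  refine Finset.sum_le_sum fun j _ => ?_
  rw [← mul_pow]
  exact pow_le_pow_left₀ (vecNorm_nonneg _) (h j) 2

lemma frobNorm_le_sqrt_card_mul {c : ℝ} (hc : 0 ≤ c) {X : Matrix ι κ ℝ}
    (h : ∀ j, vecNorm (X.col j) ≤ c) : frobNorm X ≤ √(Fintype.card κ) * c := by
  refine le_of_sq_le_sq ?_ (by positivity)
  rw [mul_pow, frobNorm_sq, Real.sq_sqrt (by positivity)]
  refine (Finset.sum_le_sum fun j _ => pow_le_pow_left₀ (vecNorm_nonneg _) (h j) 2).trans ?_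
  simp

lemma vecNorm_mulVec_le (X : Matrix ι κ ℝ) (w : κ → ℝ) :
    vecNorm (X *ᵥ w) ≤ frobNorm X * vecNorm w := by
  refine le_of_sq_le_sq ?_ (mul_nonneg (frobNorm_nonneg _) (vecNorm_nonneg _))
  rw [mul_pow, frobNorm_sq_rows, vecNorm_sq, Finset.sum_mul]
  refine Finset.sum_le_sum fun i _ => ?_
  rw [← mul_pow, ← sq_abs]
  exact pow_le_pow_left₀ (abs_nonneg _) (abs_dotProduct_le _ _) 2

lemma frobNorm_mul_le (X : Matrix ι κ ℝ) (Y : Matrix κ μ ℝ) :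
    frobNorm (X * Y) ≤ frobNorm X * frobNorm Y :=
  frobNorm_le_of_col_le (frobNorm_nonneg _) fun _ => vecNorm_mulVec_le _ _

lemma frobNorm_mul_le_of_bound {c : ℝ} (hc : 0 ≤ c) {X : Matrix ι κ ℝ}
    (h : ∀ w, vecNorm (X *ᵥ w) ≤ c * vecNorm w) (Y : Matrix κ μ ℝ) :
    frobNorm (X * Y) ≤ c * frobNorm Y :=
  frobNorm_le_of_col_le hc fun _ => h _

lemma frobNorm_submatrix_le {ι' κ' : Type} [Fintype ι'] [Fintype κ'] (X : Matrix ι κ ℝ)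
    {f : ι' → ι} {g : κ' → κ} (hf : Function.Injective f) (hg : Function.Injective g) :
    frobNorm (X.submatrix f g) ≤ frobNorm X := by
  rw [frobNorm_eq_vecNorm, frobNorm_eq_vecNorm, vecNorm_eq_sqrt, vecNorm_eq_sqrt]
  refine Real.sqrt_le_sqrt ?_
  have hi : Function.Injective (Prod.map f g) := hf.prodMap hg
  have := Finset.sum_map Finset.univ ⟨_, hi⟩ fun p : ι × κ => X p.1 p.2 ^ 2
  simp only [Function.Embedding.coeFn_mk, Prod.map_fst, Prod.map_snd] at this
  simp only [submatrix_apply]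
  rw [← this]
  exact Finset.sum_le_sum_of_subset_of_nonneg (Finset.subset_univ _) fun _ _ _ => sq_nonneg _

end frobNorm

/-! ### Spectral norm and singular values -/

section sigma

variable {ι κ : Type} [Fintype ι] [Fintype κ] [DecidableEq κ]

lemma norm_toEuclideanLin (X : Matrix ι κ ℝ) (w : κ → ℝ) :
    ‖toEuclideanLin X (WithLp.toLp 2 w)‖ = vecNorm (X *ᵥ w) := by
  simp [vecNorm, toLpLin_toLp]

lemma specNorm_nonneg (X : Matrix ι κ ℝ) : 0 ≤ specNorm X := norm_nonneg _

lemma vecNorm_mulVec_le_specNorm (X : Matrix ι κ ℝ) (w : κ → ℝ) :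
    vecNorm (X *ᵥ w) ≤ specNorm X * vecNorm w := by
  rw [← norm_toEuclideanLin]
  exact (toEuclideanLin X).toContinuousLinearMap.le_opNorm (WithLp.toLp 2 w)

lemma specNorm_le_of_bound {c : ℝ} (hc : 0 ≤ c) {X : Matrix ι κ ℝ}
    (h : ∀ w, vecNorm (X *ᵥ w) ≤ c * vecNorm w) : specNorm X ≤ c := by
  refine ContinuousLinearMap.opNorm_le_bound _ hc fun w => ?_
  have := h w.ofLp
  rwa [← norm_toEuclideanLin] at this

lemma specNorm_le_frobNorm (X : Matrix ι κ ℝ) : specNorm X ≤ frobNorm X :=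
  specNorm_le_of_bound (frobNorm_nonneg X) (vecNorm_mulVec_le X)

lemma vecNorm_col_le_specNorm (X : Matrix ι κ ℝ) (j : κ) : vecNorm (X.col j) ≤ specNorm X := by
  have := vecNorm_mulVec_le_specNorm X (Pi.single j 1)
  rw [mulVec_single_one] at this
  simpa [vecNorm] using this

lemma frobNorm_le_sqrt_card_mul_specNorm (X : Matrix ι κ ℝ) :
    frobNorm X ≤ √(Fintype.card κ) * specNorm X :=
  frobNorm_le_sqrt_card_mul (specNorm_nonneg X) (vecNorm_col_le_specNorm X)

end sigma

end CQRRPT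

/-! ### Singular values through the eigenbasis of `T* T` -/

section SingularValues

variable {E F : Type} [NormedAddCommGroup E] [InnerProductSpace ℝ E] [FiniteDimensional ℝ E]
  [NormedAddCommGroup F] [InnerProductSpace ℝ F] [FiniteDimensional ℝ F]

/-- `‖T x‖² = ⟨T* T x, x⟩`, and `T* T` is diagonal in its eigenbasis with eigenvalues `σ_i²`. The
extremal properties of singular values used below are read off from this expansion. -/
lemma LinearMap.norm_apply_sq_eq_sum_singularValues (T : E →ₗ[ℝ] F) {p : ℕ}
    (hp : Module.finrank ℝ E = p) (x : E) :
    ‖T x‖ ^ 2 = ∑ i : Fin p, T.singularValues i ^ 2 *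
      (T.isSymmetric_adjoint_comp_self.eigenvectorBasis hp).repr x i ^ 2 := by
  set b := T.isSymmetric_adjoint_comp_self.eigenvectorBasis hp with hb
  have h1 : ‖T x‖ ^ 2 = inner ℝ ((adjoint T ∘ₗ T) x) x := by
    rw [LinearMap.comp_apply, LinearMap.adjoint_inner_left, real_inner_self_eq_norm_sq]
  rw [h1, ← b.repr.inner_map_map, PiLp.inner_apply]
  refine Finset.sum_congr rfl fun i _ => ?_
  rw [hb, T.isSymmetric_adjoint_comp_self.eigenvectorBasis_apply_self_apply hp,
    T.sq_singularValues_fin hp]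
  simp
  ring

lemma LinearMap.norm_apply_le_singularValues_zero (T : E →ₗ[ℝ] F) (x : E) :
    ‖T x‖ ≤ T.singularValues 0 * ‖x‖ := by
  refine le_of_sq_le_sq ?_ (mul_nonneg (T.singularValues_nonneg 0) (norm_nonneg _))
  rw [T.norm_apply_sq_eq_sum_singularValues rfl, mul_pow,
    ← (T.isSymmetric_adjoint_comp_self.eigenvectorBasis rfl).repr.norm_map x,
    EuclideanSpace.norm_sq_eq, Finset.mul_sum]
  refine Finset.sum_le_sum fun i _ => ?_
  rw [Real.norm_eq_abs, sq_abs]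
  exact mul_le_mul_of_nonneg_right (pow_le_pow_left₀ (T.singularValues_nonneg _)
    (T.singularValues_antitone (Nat.zero_le _)) 2) (sq_nonneg _)

lemma LinearMap.singularValues_last_mul_norm_le (T : E →ₗ[ℝ] F) (x : E) :
    T.singularValues (Module.finrank ℝ E - 1) * ‖x‖ ≤ ‖T x‖ := by
  refine le_of_sq_le_sq ?_ (norm_nonneg _)
  rw [T.norm_apply_sq_eq_sum_singularValues rfl, mul_pow,
    ← (T.isSymmetric_adjoint_comp_self.eigenvectorBasis rfl).repr.norm_map x,
    EuclideanSpace.norm_sq_eq, Finset.mul_sum]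
  refine Finset.sum_le_sum fun i _ => ?_
  rw [Real.norm_eq_abs, sq_abs]
  exact mul_le_mul_of_nonneg_right (pow_le_pow_left₀ (T.singularValues_nonneg _)
    (T.singularValues_antitone (Nat.le_sub_one_of_lt i.2)) 2) (sq_nonneg _)

lemma LinearMap.exists_norm_apply_eq_singularValues (T : E →ₗ[ℝ] F) {i : ℕ}
    (hi : i < Module.finrank ℝ E) : ∃ x : E, ‖x‖ = 1 ∧ ‖T x‖ = T.singularValues i := by
  set b := T.isSymmetric_adjoint_comp_self.eigenvectorBasis rfl with hb
  refine ⟨b ⟨i, hi⟩, b.orthonormal.1 _, ?_⟩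
  refine (pow_left_inj₀ (norm_nonneg _) (T.singularValues_nonneg i) two_ne_zero).1 ?_
  rw [T.norm_apply_sq_eq_sum_singularValues rfl, ← hb, Finset.sum_eq_single ⟨i, hi⟩]
  · simp
  · intro j _ hj
    simp [b.repr_self, hj]
  · simp

end SingularValues

namespace CQRRPT

/-! ### Extreme singular values, embeddings and almost orthonormal factors -/

section sigmaMin

variable {ι : Type} [Fintype ι] {p : ℕ}

lemma vecNorm_mulVec_le_sigma_one (X : Matrix ι (Fin p) ℝ) (w : Fin p → ℝ) :
    vecNorm (X *ᵥ w) ≤ sigma X 1 * vecNorm w := by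
  rw [← norm_toEuclideanLin]
  exact (toEuclideanLin X).norm_apply_le_singularValues_zero (WithLp.toLp 2 w)

lemma sigmaMin_mul_vecNorm_le (X : Matrix ι (Fin p) ℝ) (w : Fin p → ℝ) :
    sigmaMin X * vecNorm w ≤ vecNorm (X *ᵥ w) := by
  rw [← norm_toEuclideanLin]
  have := (toEuclideanLin X).singularValues_last_mul_norm_le (WithLp.toLp 2 w)
  rwa [finrank_euclideanSpace_fin] at this

lemma exists_vecNorm_mulVec_eq_sigma (X : Matrix ι (Fin p) ℝ) {j : ℕ} (h1 : 1 ≤ j) (hj : j ≤ p) :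
    ∃ w, vecNorm w = 1 ∧ vecNorm (X *ᵥ w) = sigma X j := by
  obtain ⟨w, hw, h⟩ := (toEuclideanLin X).exists_norm_apply_eq_singularValues (i := j - 1)
    (by simp; omega)
  refine ⟨w.ofLp, hw, ?_⟩
  rw [← norm_toEuclideanLin]
  exact h

/-- The largest and smallest singular values are attained at unit vectors, so two-sided bounds on
`|X w|` bracket both of them. -/
lemma cond_le_of_bounds (hp : 1 ≤ p) {X : Matrix ι (Fin p) ℝ} {a b : ℝ} (ha : 0 < a)
    (hlo : ∀ w, a * vecNorm w ≤ vecNorm (X *ᵥ w)) (hup : ∀ w, vecNorm (X *ᵥ w) ≤ b * vecNorm w) :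
    0 < sigmaMin X ∧ cond X ≤ b / a := by
  obtain ⟨v, hv, h⟩ := exists_vecNorm_mulVec_eq_sigma X hp le_rfl
  obtain ⟨v', hv', h'⟩ := exists_vecNorm_mulVec_eq_sigma X le_rfl hp
  have h1 : a ≤ sigmaMin X := by simpa [hv, h, sigmaMin] using hlo v
  have h2 : sigma X 1 ≤ b := by simpa [hv', h'] using hup v'
  have h3 : a ≤ b := by simpa [hv] using (hlo v).trans (hup v)
  exact ⟨ha.trans_le h1, div_le_div₀ (ha.le.trans h3) h2 ha h1⟩

lemma vecNorm_mulVec_of_orthonormal {m : ℕ} {U : Matrix (Fin m) (Fin p) ℝ} (hU : Uᵀ * U = 1)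
    (w : Fin p → ℝ) : vecNorm (U *ᵥ w) = vecNorm w := by
  refine (pow_left_inj₀ (vecNorm_nonneg _) (vecNorm_nonneg _) two_ne_zero).1 ?_
  rw [← dotProduct_self_eq_vecNorm_sq, ← dotProduct_self_eq_vecNorm_sq, dotProduct_mulVec,
    vecMul_mulVec, hU, vecMul_one]

/-- Writing `x = U w` with `U` isometric gives `|x| = |w|` and `|S x| = |(S U) w|`. This is the only
form in which the embedding property is used. -/
lemma IsEmbedding.bounds {m d : ℕ} {δ : ℝ} {S : Matrix (Fin d) (Fin m) ℝ}
    {L : Submodule ℝ (Fin m → ℝ)} (h : IsEmbedding δ S L) {x : Fin m → ℝ} (hx : x ∈ L) :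
    (1 - δ) * vecNorm x ≤ vecNorm (S *ᵥ x) ∧ vecNorm (S *ᵥ x) ≤ (1 + δ) * vecNorm x := by
  obtain ⟨-, -, p, U, hU, rfl, hσ⟩ := h
  obtain ⟨w, rfl⟩ := hx
  rw [mulVecLin_apply, vecNorm_mulVec_of_orthonormal hU, mulVec_mulVec]
  rcases Nat.eq_zero_or_pos p with rfl | hp
  · rw [Subsingleton.elim w 0]
    simp only [mulVec_zero, vecNorm_zero, mul_zero, le_refl, and_self]
  · exact ⟨(mul_le_mul_of_nonneg_right (hσ p hp le_rfl).1 (vecNorm_nonneg _)).trans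
      (sigmaMin_mul_vecNorm_le _ _), (vecNorm_mulVec_le_sigma_one _ _).trans
      (mul_le_mul_of_nonneg_right (hσ 1 le_rfl hp).2 (vecNorm_nonneg _))⟩

/-- `|Q w|² - |w|²` is the quadratic form of `Qᵀ Q - 1`, and `(1 - ε)² ≤ 1 - ε`, `1 + ε ≤ (1 + ε)²`
for `0 ≤ ε ≤ 1`. -/
lemma vecNorm_mulVec_bounds_of_almost_orthonormal {d r : ℕ} {Q : Matrix (Fin d) (Fin r) ℝ} {ε : ℝ}
    (hε : ε ≤ 1) (hQ : frobNorm (Qᵀ * Q - 1) ≤ ε) (w : Fin r → ℝ) :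
    (1 - ε) * vecNorm w ≤ vecNorm (Q *ᵥ w) ∧ vecNorm (Q *ᵥ w) ≤ (1 + ε) * vecNorm w := by
  have hε0 : 0 ≤ ε := (frobNorm_nonneg _).trans hQ
  have key : |vecNorm (Q *ᵥ w) ^ 2 - vecNorm w ^ 2| ≤ ε * vecNorm w ^ 2 := by
    have h1 : vecNorm (Q *ᵥ w) ^ 2 - vecNorm w ^ 2 = w ⬝ᵥ ((Qᵀ * Q - 1) *ᵥ w) := by
      rw [sub_mulVec, one_mulVec, dotProduct_sub, ← mulVec_mulVec, ← dotProduct_self_eq_vecNorm_sq,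
        ← dotProduct_self_eq_vecNorm_sq, dotProduct_mulVec w, vecMul_transpose]
    rw [h1]
    refine (abs_dotProduct_le _ _).trans ?_
    have := (vecNorm_mulVec_le (Qᵀ * Q - 1) w).trans
      (mul_le_mul_of_nonneg_right hQ (vecNorm_nonneg w))
    nlinarith [vecNorm_nonneg w]
  have hw := vecNorm_nonneg w
  have h := abs_le.1 key
  constructor
  · refine le_of_sq_le_sq ?_ (vecNorm_nonneg _)
    nlinarith [sq_nonneg (vecNorm w),
      mul_nonneg (mul_nonneg hε0 (sub_nonneg.2 hε)) (sq_nonneg (vecNorm w))]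
  · refine le_of_sq_le_sq ?_ (by positivity)
    nlinarith [sq_nonneg (vecNorm w), mul_nonneg hε0 (sq_nonneg (vecNorm w)),
      mul_nonneg (mul_nonneg hε0 hε0) (sq_nonneg (vecNorm w))]

end sigmaMin

/-! ### Rounding errors of sums -/

lemma Rounds.abs_sub_le {u x y : ℝ} (h : Rounds u x y) : |y - x| ≤ u * |x| := by
  obtain ⟨ε, hε, rfl⟩ := h
  rw [show x * (1 + ε) - x = ε * x by ring, abs_mul]
  exact mul_le_mul_of_nonneg_right hε (abs_nonneg x)

lemma SumTree.card_leaves_pos {ι : Type} (T : SumTree ι) : 1 ≤ T.leaves.card := by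
  induction T with
  | leaf i => simp [SumTree.leaves]
  | add a b iha ihb => simp only [SumTree.leaves, Multiset.card_add]; omega

/-- If all partial sums of the vectors `x · o` are bounded by `B`, then the rounding error made in
summing them along `T` (in each coordinate) is at most `((1 + u) ^ (N - 1) - 1) * B`, where `N` is the
number of terms. -/
lemma SumTree.vecNorm_error_le {ι κ : Type} [Fintype κ] {u B : ℝ} (hu : 0 ≤ u) (x : κ → ι → ℝ)
    (T : SumTree ι) (s : κ → ℝ)
    (hB : ∀ L ≤ T.leaves, vecNorm (fun i => (L.map (x i)).sum) ≤ B)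
    (h : ∀ i, T.Evaluates u (x i) (s i)) :
    vecNorm (fun i => s i - (T.leaves.map (x i)).sum) ≤ ((1 + u) ^ (T.leaves.card - 1) - 1) * B := by
  induction T generalizing s with
  | leaf o =>
    have : (fun i => s i - ((SumTree.leaf o).leaves.map (x i)).sum) = 0 := by
      ext i
      simp [SumTree.leaves, show s i = x i o from h i]
    rw [this]
    simp [SumTree.leaves]
  | add a b iha ihb =>
    choose sa sb ha hb hs using h
    have ea := iha sa (fun L hL => hB L (hL.trans (Multiset.le_add_right _ _))) ha
    have eb := ihb sb (fun L hL => hB L (hL.trans (Multiset.le_add_left _ _))) hb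
    set ya : κ → ℝ := fun i => (a.leaves.map (x i)).sum with hya
    set yb : κ → ℝ := fun i => (b.leaves.map (x i)).sum with hyb
    have hy : vecNorm (ya + yb) ≤ B := by
      convert! hB (a.leaves + b.leaves) le_rfl using 2
      ext i
      simp [hya, hyb]
    have hB0 : 0 ≤ B := (vecNorm_nonneg _).trans hy
    have e1 : vecNorm (s - (sa + sb)) ≤ u * vecNorm (sa + sb) :=
      vecNorm_le_mul_of_abs_le hu fun i => (hs i).abs_sub_le
    have e2 : vecNorm (sa + sb) ≤ vecNorm (sa - ya) + vecNorm (sb - yb) + vecNorm (ya + yb) := by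
      rw [show sa + sb = (sa - ya) + (sb - yb) + (ya + yb) by abel]
      exact (vecNorm_add_le _ _).trans (add_le_add_left (vecNorm_add_le _ _) _)
    have e3 : vecNorm (fun i => s i - (((SumTree.add a b).leaves).map (x i)).sum) ≤
        vecNorm (s - (sa + sb)) + (vecNorm (sa - ya) + vecNorm (sb - yb)) := by
      have : (fun i => s i - (((SumTree.add a b).leaves).map (x i)).sum) =
          (s - (sa + sb)) + ((sa - ya) + (sb - yb)) := by
        ext i
        simp [SumTree.leaves, hya, hyb]
        ring
      rw [this]
      exact (vecNorm_add_le _ _).trans (add_le_add_right (vecNorm_add_le _ _) _)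
    have hca := a.card_leaves_pos
    have hcb := b.card_leaves_pos
    have hcard : (SumTree.add a b).leaves.card - 1 =
        (a.leaves.card - 1) + (b.leaves.card - 1) + 1 := by
      simp only [SumTree.leaves, Multiset.card_add]; omega
    rw [hcard, pow_succ, pow_add]
    set p := (1 + u) ^ (a.leaves.card - 1)
    set q := (1 + u) ^ (b.leaves.card - 1)
    have hp : 1 ≤ p := one_le_pow₀ (by linarith)
    have hq : 1 ≤ q := one_le_pow₀ (by linarith)
    have ea' : vecNorm (sa - ya) ≤ (p - 1) * B := ea
    have eb' : vecNorm (sb - yb) ≤ (q - 1) * B := eb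
    -- `(p - 1) + (q - 1) ≤ p q - 1`, the difference being `(p - 1)(q - 1)`. The final addition then
    -- contributes one more factor `1 + u`.
    have h1 : vecNorm (sa - ya) + vecNorm (sb - yb) ≤ (p * q - 1) * B := by
      nlinarith [mul_nonneg (mul_nonneg (sub_nonneg.2 hp) (sub_nonneg.2 hq)) hB0]
    have h2 : u * vecNorm (sa + sb) ≤ u * ((p * q - 1) * B + B) :=
      mul_le_mul_of_nonneg_left (by linarith) hu
    calc _ ≤ u * ((p * q - 1) * B + B) + (p * q - 1) * B := by linarith
      _ = _ := by ring

/-- Version of `SumTree.vecNorm_error_le` for a tree summing over a finite type. -/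
lemma SumTree.vecNorm_error_le_of_univ {ι κ : Type} [Fintype ι] [Fintype κ] {u B : ℝ}
    (hu : 0 ≤ u) (x : κ → ι → ℝ) {T : SumTree ι} (hT : T.leaves = Finset.univ.val) (s : κ → ℝ)
    (hB : ∀ L : Finset ι, vecNorm (fun i => ∑ o ∈ L, x i o) ≤ B)
    (h : ∀ i, T.Evaluates u (x i) (s i)) :
    vecNorm (fun i => s i - ∑ o, x i o) ≤ ((1 + u) ^ (Fintype.card ι - 1) - 1) * B := by
  have := T.vecNorm_error_le hu x s (B := B) (fun L hL => ?_) h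
  · rw [hT] at this
    exact this
  · rw [hT] at hL
    exact hB ⟨L, Multiset.nodup_of_le hL Finset.univ.nodup⟩

lemma one_add_pow_sub_one_le {u : ℝ} (hu : 0 ≤ u) {v : ℕ} (h : v * u ≤ 1 / 1000) :
    (1 + u) ^ v - 1 ≤ 1001 / 1000 * (v * u) := by
  have h1 : (1 + u) ^ v ≤ Real.exp (v * u) := by
    rw [Real.exp_nat_mul]
    exact pow_le_pow_left₀ (by linarith) (by linarith [Real.add_one_le_exp u]) v
  have h0 : 0 ≤ (v : ℝ) * u := by positivity
  have h2 := Real.abs_exp_sub_one_sub_id_le (x := v * u) (by rw [abs_of_nonneg h0]; linarith)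
  have h3 := (abs_le.1 h2).2
  nlinarith

/-! ### Substitution -/

lemma sum_subtype_eq_sum_dite {κ : Type} [Fintype κ] (p : κ → Prop) [DecidablePred p]
    (f : {l // p l} → ℝ) : ∑ l, f l = ∑ l, if h : p l then f ⟨l, h⟩ else 0 := by
  rw [Finset.sum_dite, Finset.sum_const_zero, add_zero]
  symm
  refine Finset.sum_bij' (fun l _ => ⟨l.1, (Finset.mem_filter.1 l.2).2⟩)
    (fun l _ => ⟨l.1, by simp [l.2]⟩) ?_ ?_ ?_ ?_ ?_ <;> simp

/-- One order of summation serves all rows, so every partial sum of column `j` is, up to small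
errors, a vector `P y` with `|y i| ≤ |A i j|`. Its length is therefore at most `p |A_j|`, with no
factor depending on `m`. The bound is relative to `P` and `A`, not to `X`. -/
lemma FlTrsm.vecNorm_col_le {m k : ℕ} {u p : ℝ} (hu : 0 ≤ u) (huk : k * u ≤ 1 / 1000)
    {X P : Matrix (Fin m) (Fin k) ℝ} {A : Matrix (Fin k) (Fin k) ℝ}
    (hA : ∀ i j, j < i → A i j = 0) (hA0 : ∀ j, A j j ≠ 0) (h : FlTrsm u X A P) (hp0 : 0 ≤ p)
    (hp : ∀ w, vecNorm (P *ᵥ w) ≤ p * vecNorm w) (j : Fin k) :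
    vecNorm ((X - P * A).col j) ≤ 38 / 25 * (k * u) * (p * vecNorm (A.col j)) := by
  obtain ⟨T, hT, hrow⟩ := h j
  choose q s hq hs hP using hrow
  set a := vecNorm (A.col j) with ha
  have ha0 : 0 ≤ a := vecNorm_nonneg _
  set b := p * a with hb
  have hb0 : 0 ≤ b := mul_nonneg hp0 ha0
  set ρ := vecNorm ((X - P * A).col j) with hρ
  have hρ0 : 0 ≤ ρ := vecNorm_nonneg _
  set v : ℕ := j.val with hv
  have hcardl : Fintype.card {l : Fin k // l < j} = v := by
    rw [Fintype.card_subtype, hv, ← Fin.card_Iio j]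
    congr 1
    ext l
    simp
  have hPcol : ∀ l, vecNorm (P.col l) ≤ p := fun l => by
    have := hp (Pi.single l 1)
    rw [mulVec_single_one] at this
    simpa [vecNorm] using this
  -- rounding errors of the products
  set e : {l : Fin k // l < j} → Fin m → ℝ := fun l i => q i l - P i l.1 * A l.1 j with he
  have hel : ∀ l, vecNorm (e l) ≤ u * p * |A l.1 j| := fun l => by
    have h1 : vecNorm (e l) ≤ u * vecNorm ((A l.1 j) • P.col l.1) := by
      refine vecNorm_le_mul_of_abs_le hu fun i => ?_
      refine (hq i l).abs_sub_le.trans_eq ?_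
      simp [mul_comm]
    rw [vecNorm_smul] at h1
    calc _ ≤ _ := h1
      _ ≤ u * (|A l.1 j| * p) := by gcongr; exact hPcol _
      _ = _ := by ring
  have hesum : ∑ l, vecNorm (e l) ≤ u * √v * b := by
    have h1 : ∑ l : {l : Fin k // l < j}, |A l.1 j| ≤ √v * a := by
      refine (sum_abs_le_sqrt_card_mul_vecNorm fun l : {l : Fin k // l < j} => A l.1 j).trans ?_
      rw [hcardl]
      refine mul_le_mul_of_nonneg_left ?_ (Real.sqrt_nonneg _)
      refine le_of_sq_le_sq ?_ ha0
      rw [ha, vecNorm_sq, vecNorm_sq, sum_subtype_eq_sum_dite (· < j) fun l => A l.1 j ^ 2]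
      refine Finset.sum_le_sum fun l _ => ?_
      split_ifs
      · exact le_rfl
      · exact sq_nonneg _
    calc _ ≤ ∑ l : {l : Fin k // l < j}, u * p * |A l.1 j| := Finset.sum_le_sum fun l _ => hel l
      _ = u * p * ∑ l : {l : Fin k // l < j}, |A l.1 j| := by rw [Finset.mul_sum]
      _ ≤ u * p * (√v * a) := by gcongr
      _ = _ := by rw [hb]; ring
  -- bound for weighted sums of the exact products
  have hw : ∀ c : Fin k → ℝ, (∀ l, |c l| ≤ 1) →
      vecNorm (P *ᵥ fun l => c l * A l j) ≤ b := fun c hc => by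
    refine (hp _).trans (mul_le_mul_of_nonneg_left (vecNorm_le_of_abs_le fun l => ?_) hp0)
    rw [abs_mul]
    exact mul_le_of_le_one_left (abs_nonneg _) (hc l)
  have hsub : ∀ c : {l : Fin k // l < j} → ℝ, ∀ i, ∑ l, c l * q i l =
      (P *ᵥ fun l => (if h : l < j then c ⟨l, h⟩ else 0) * A l j) i + ∑ l, c l * e l i := by
    intro c i
    have : ∀ l, c l * q i l = c l * (P i l.1 * A l.1 j) + c l * e l i := fun l => by
      simp only [he]; ring
    rw [Finset.sum_congr rfl fun l _ => this l, Finset.sum_add_distrib,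
      sum_subtype_eq_sum_dite (· < j) fun l => c l * (P i l.1 * A l.1 j)]
    congr 1
    refine Finset.sum_congr rfl fun l _ => ?_
    by_cases h : l < j
    · simp only [h, dite_true]; ring
    · simp only [h, dite_false, zero_mul, mul_zero]
  have hesub : ∀ c : {l : Fin k // l < j} → ℝ, (∀ l, |c l| ≤ 1) →
      vecNorm (fun i => ∑ l, c l * e l i) ≤ u * √v * b := fun c hc => by
    have : (fun i => ∑ l, c l * e l i) = ∑ l, c l • e l := by
      ext i; simp [Finset.sum_apply]
    rw [this]
    refine ((vecNorm_sum_le _ _).trans (Finset.sum_le_sum fun l _ => ?_)).trans hesum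
    rw [vecNorm_smul]
    exact mul_le_of_le_one_left (vecNorm_nonneg _) (hc l)
  set x : Fin m → Option {l : Fin k // l < j} → ℝ :=
    fun i o => o.elim (X i j) (fun l => -q i l) with hx
  have hXcol : ∀ i, X i j = (X - P * A).col j i + (P *ᵥ A.col j) i := fun i => by
    rw [← col_mul]; simp
  -- The partial sums involve `X_j = P A_j + residual`, so their bound contains the quantity `ρ`
  -- being estimated; it is absorbed at the end.
  have hB : ∀ L : Finset (Option {l : Fin k // l < j}),
      vecNorm (fun i => ∑ o ∈ L, x i o) ≤ b + u * √v * b + ρ := by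
    intro L
    set c : {l : Fin k // l < j} → ℝ := fun l => if some l ∈ L then 1 else 0 with hc
    have hc1 : ∀ l, |c l| ≤ 1 := fun l => by simp only [hc]; split_ifs <;> simp
    have hsum : ∀ i, ∑ o ∈ L, x i o =
        (if none ∈ L then X i j else 0) - ∑ l, c l * q i l := fun i => by
      have h1 : ∑ o ∈ L, x i o = ∑ o, if o ∈ L then x i o else 0 := by
        rw [Finset.sum_ite_mem, Finset.univ_inter]
      rw [h1, Fintype.sum_option, sub_eq_add_neg, ← Finset.sum_neg_distrib]
      refine congrArg₂ _ rfl (Finset.sum_congr rfl fun l _ => ?_)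
      simp only [hx, hc, Option.elim_some]
      split_ifs <;> simp
    set z : ℝ := if none ∈ L then 1 else 0 with hz
    have hz1 : |z| ≤ 1 := by simp only [hz]; split_ifs <;> simp
    -- The weights `z - c l` lie in {-1, 0, 1}: with `X_j` present, a selected product cancels
    -- against its share of `P A_j`.
    have hdecomp : (fun i => ∑ o ∈ L, x i o) = z • (X - P * A).col j +
        (P *ᵥ fun l => (z - if h : l < j then c ⟨l, h⟩ else 0) * A l j) -
        fun i => ∑ l, c l * e l i := by
      ext i
      have h2 : (P *ᵥ fun l => (z - if h : l < j then c ⟨l, h⟩ else 0) * A l j) =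
          z • (P *ᵥ A.col j) - P *ᵥ fun l => (if h : l < j then c ⟨l, h⟩ else 0) * A l j := by
        rw [← mulVec_smul, ← mulVec_sub]
        congr 1
        ext l
        simp [sub_mul]
      have h3 : (if none ∈ L then X i j else 0) = z * X i j := by
        simp only [hz]; split_ifs <;> simp
      rw [hsum, hsub, h2, h3, hXcol]
      simp only [Pi.sub_apply, Pi.add_apply, Pi.smul_apply, smul_eq_mul]
      ring
    rw [hdecomp]
    refine (vecNorm_sub_le _ _).trans ?_
    have h4 : vecNorm (z • (X - P * A).col j) ≤ ρ := by
      rw [vecNorm_smul]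
      exact mul_le_of_le_one_left hρ0 hz1
    have h5 := hw (fun l => z - if h : l < j then c ⟨l, h⟩ else 0) (fun l => by
      simp only [hz, hc]; split_ifs <;> simp)
    linarith [vecNorm_add_le (z • (X - P * A).col j)
      (P *ᵥ fun l => (z - if h : l < j then c ⟨l, h⟩ else 0) * A l j), hesub c hc1]
  have hE := SumTree.vecNorm_error_le_of_univ hu x hT s hB hs
  rw [Fintype.card_option, hcardl, Nat.add_sub_cancel] at hE
  -- the rounding error of the division
  have hPA : ∀ i, ∃ ε : ℝ, |ε| ≤ u ∧ P i j * A j j = s i * (1 + ε) := fun i => by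
    obtain ⟨ε, hε, h⟩ := hP i
    refine ⟨ε, hε, ?_⟩
    rw [h]
    field_simp [hA0 j]
  set f : Fin m → ℝ := fun i => s i - P i j * A j j with hf
  have hfs : vecNorm f ≤ u * vecNorm s := by
    refine vecNorm_le_mul_of_abs_le hu fun i => ?_
    obtain ⟨ε, hε, h⟩ := hPA i
    simp only [hf]
    rw [h, show s i - s i * (1 + ε) = -(ε * s i) by ring, abs_neg, abs_mul]
    gcongr
  -- The division error is relative to `s`, which is itself `f` plus `A j j • P_j`; hence `|f| ≤ u
  -- (|f| + b)`, solved for `|f|` below.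
  have hsb : vecNorm s ≤ vecNorm f + b := by
    have h1 : s = f + A j j • P.col j := by
      ext i; simp [hf]; ring
    have h2 : vecNorm (A j j • P.col j) ≤ b := by
      rw [vecNorm_smul, mul_comm, hb]
      exact mul_le_mul (hPcol j) (abs_le_vecNorm (A.col j) j) (abs_nonneg _) hp0
    calc vecNorm s = vecNorm (f + A j j • P.col j) := by rw [← h1]
      _ ≤ _ := (vecNorm_add_le _ _).trans (by linarith)
  have hres : (X - P * A).col j = -(fun i => s i - ∑ o, x i o) +
      (fun i => ∑ l, (1 : ℝ) * e l i) + f := by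
    ext i
    have h1 : ∑ o, x i o = X i j - ∑ l, (1 : ℝ) * q i l := by
      rw [Fintype.sum_option, sub_eq_add_neg, ← Finset.sum_neg_distrib]
      simp [hx]
    have h2 : (P *ᵥ A.col j) i =
        (P *ᵥ fun l => (if h : l < j then (1 : ℝ) else 0) * A l j) i + P i j * A j j := by
      rw [mulVec, dotProduct, mulVec, dotProduct,
        ← Finset.sum_erase_add _ _ (Finset.mem_univ j),
        ← Finset.sum_erase_add _ (fun l => P i l * _) (Finset.mem_univ j)]
      simp only [lt_irrefl, dite_eq_ite, if_false, zero_mul, mul_zero, add_zero]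
      congr 1
      refine Finset.sum_congr rfl fun l hl => ?_
      rcases lt_or_gt_of_ne (Finset.ne_of_mem_erase hl) with hlj | hlj
      · simp [hlj]
      · simp [hA l j hlj]
    have h3 := hXcol i
    simp only [Pi.add_apply, Pi.neg_apply, hf]
    rw [h1, hsub]
    linarith
  have hρle : ρ ≤ ((1 + u) ^ v - 1) * (b + u * √v * b + ρ) + u * √v * b + vecNorm f := by
    have h1 := vecNorm_add_le (-(fun i => s i - ∑ o, x i o) + (fun i => ∑ l, (1 : ℝ) * e l i)) f
    have h2 := vecNorm_add_le (-(fun i => s i - ∑ o, x i o)) (fun i => ∑ l, (1 : ℝ) * e l i)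
    rw [vecNorm_neg] at h2
    have h3 := hesub (fun _ => 1) (fun _ => by simp)
    rw [← hres] at h1
    linarith
  have hvk : (v : ℝ) + 1 ≤ k := by exact_mod_cast j.2
  have hv0 : (0 : ℝ) ≤ v := Nat.cast_nonneg v
  -- `2 √v ≤ v + 1 ≤ k`. The product errors thus cost about `k u / 2`, additions and division
  -- together about `k u`; 38/25 leaves room for second-order terms.
  have hsq : √(v : ℝ) ≤ k / 2 := by
    nlinarith [Real.sq_sqrt hv0, sq_nonneg (√(v : ℝ) - 1)]
  set K : ℝ := k * u with hK
  have hvK : v * u ≤ K - u := by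
    rw [hK]; nlinarith
  have huK : u ≤ K := by nlinarith [mul_nonneg hv0 hu]
  have hg := one_add_pow_sub_one_le hu (v := v) (by linarith)
  have hsK : u * √v ≤ K / 2 := by
    rw [hK]; nlinarith
  have hf2 : vecNorm f ≤ 501 / 500 * u * b := by
    have hf0 := vecNorm_nonneg f
    have h1 : vecNorm f ≤ u * (vecNorm f + b) := hfs.trans (mul_le_mul_of_nonneg_left hsb hu)
    have h2 : u * vecNorm f ≤ 1 / 1000 * vecNorm f :=
      mul_le_mul_of_nonneg_right (by linarith) hf0
    nlinarith [mul_nonneg hu hb0]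
  have hg2 : (1 + u) ^ v - 1 ≤ 1001 / 1000 * (K - u) := by linarith
  have hub : 0 ≤ u * b := mul_nonneg hu hb0
  have hKb : u * b ≤ K * b := mul_le_mul_of_nonneg_right huK hb0
  have hsKb : u * √v * b ≤ K / 2 * b := mul_le_mul_of_nonneg_right hsK hb0
  have hKKb : K * (K * b) ≤ 1 / 1000 * (K * b) :=
    mul_le_mul_of_nonneg_right huk (by linarith)
  have hsKb' : u * √v * b ≤ 1 / 2000 * b := hsKb.trans (mul_le_mul_of_nonneg_right (by linarith) hb0)
  have hfin : ((1 + u) ^ v - 1) * (b + u * √v * b + ρ) ≤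
      1001 / 1000 * (K - u) * (2001 / 2000 * b + ρ) :=
    mul_le_mul hg2 (by linarith) (by positivity) (by linarith)
  have hKρ : K * ρ ≤ 1 / 1000 * ρ := mul_le_mul_of_nonneg_right huk hρ0
  nlinarith [mul_nonneg hu hρ0]

/-! ### Blocks -/

lemma vecNorm_comp_castLE {r k : ℕ} (hr : k ≤ r) {v : Fin r → ℝ} (hv : ∀ i, k ≤ i.val → v i = 0) :
    vecNorm (fun i => v (Fin.castLE hr i)) = vecNorm v := by
  rw [vecNorm_eq_sqrt, vecNorm_eq_sqrt]
  congr 1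
  have := Finset.sum_map Finset.univ (Fin.castLEEmb hr) fun i => v i ^ 2
  simp only [Fin.castLEEmb_apply] at this
  rw [← this]
  refine Finset.sum_subset (Finset.subset_univ _) fun i _ hi => ?_
  rw [hv i, zero_pow two_ne_zero]
  by_contra! h
  exact hi (Finset.mem_map.2 ⟨⟨i, h⟩, Finset.mem_univ _, rfl⟩)

lemma vecNorm_comp_val {r k : ℕ} {v : Fin r → ℝ} (hv : ∀ i, i.val < k → v i = 0) :
    vecNorm (fun i : {i : Fin r // k ≤ i.val} => v i) = vecNorm v := by
  rw [vecNorm_eq_sqrt, vecNorm_eq_sqrt, sum_subtype_eq_sum_dite (fun i : Fin r => k ≤ i.val)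
    fun i => v i ^ 2]
  congr 1
  refine Finset.sum_congr rfl fun i _ => ?_
  split_ifs with h
  · rfl
  · rw [hv i (not_le.1 h), zero_pow two_ne_zero]

/-- The columns of `X` from the index `k` on. -/
def lastCols {ι : Type} {n : ℕ} (k : ℕ) (X : Matrix ι (Fin n) ℝ) :
    Matrix ι {j : Fin n // k ≤ j.val} ℝ := X.submatrix id Subtype.val

lemma frobNorm_firstCols_le {ι : Type} [Fintype ι] {n k : ℕ} (hn : k ≤ n)
    (X : Matrix ι (Fin n) ℝ) : frobNorm (firstCols hn X) ≤ frobNorm X :=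
  frobNorm_submatrix_le X Function.injective_id (Fin.castLE_injective hn)

lemma frobNorm_lastCols_le {ι : Type} [Fintype ι] {n k : ℕ} (X : Matrix ι (Fin n) ℝ) :
    frobNorm (lastCols k X) ≤ frobNorm X :=
  frobNorm_submatrix_le X Function.injective_id Subtype.val_injective

lemma frobNorm_le_firstCols_add_lastCols {ι : Type} [Fintype ι] {n k : ℕ} (hn : k ≤ n)
    (X : Matrix ι (Fin n) ℝ) :
    frobNorm X ≤ frobNorm (firstCols hn X) + frobNorm (lastCols k X) := by
  refine le_of_sq_le_sq ?_ (add_nonneg (frobNorm_nonneg _) (frobNorm_nonneg _))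
  have h : frobNorm X ^ 2 = frobNorm (firstCols hn X) ^ 2 + frobNorm (lastCols k X) ^ 2 := by
    simp only [frobNorm_sq_rows, vecNorm_sq]
    rw [← Finset.sum_add_distrib]
    refine Finset.sum_congr rfl fun i _ => ?_
    have h1 := vecNorm_comp_castLE hn (v := fun j => if k ≤ j.val then 0 else X i j)
      (fun j hj => by simp [hj])
    have h2 := vecNorm_comp_val (k := k) (v := fun j : Fin n => if k ≤ j.val then X i j else 0)
      (fun j hj => by simp [hj])
    rw [← pow_left_inj₀ (vecNorm_nonneg _) (vecNorm_nonneg _) two_ne_zero, vecNorm_sq, vecNorm_sq]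
      at h1 h2
    have h3 : ∑ j, X i j ^ 2 = ∑ j : Fin n, (if k ≤ j.val then 0 else X i j) ^ 2 +
        ∑ j : Fin n, (if k ≤ j.val then X i j else 0) ^ 2 := by
      rw [← Finset.sum_add_distrib]
      refine Finset.sum_congr rfl fun j _ => ?_
      split_ifs <;> simp
    rw [h3, ← h1, ← h2]
    refine congrArg₂ _ (Finset.sum_congr rfl fun j _ => ?_) (Finset.sum_congr rfl fun j _ => ?_)
    · have : ¬ k ≤ j.val := by omega
      simp [this, firstCols]
    · simp [j.2, lastCols]
  rw [h]
  nlinarith [mul_nonneg (frobNorm_nonneg (firstCols hn X)) (frobNorm_nonneg (lastCols k X))]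

lemma firstCols_mulVec_mem_range {m n k : ℕ} (hn : k ≤ n) (X : Matrix (Fin m) (Fin n) ℝ)
    (w : Fin k → ℝ) : firstCols hn X *ᵥ w ∈ LinearMap.range X.mulVecLin := by
  have : firstCols hn X *ᵥ w = ∑ l, w l • X.col (Fin.castLE hn l) := by
    ext i
    simp [mulVec, dotProduct, firstCols, mul_comm]
  rw [this]
  refine Submodule.sum_mem _ fun l _ => Submodule.smul_mem _ _ ⟨Pi.single (Fin.castLE hn l) 1, ?_⟩
  simp

/-- The rows of the first `k` columns below row `k` vanish by triangularity. -/
lemma vecNorm_firstCols_mulVec_of_upper {r n k : ℕ} (hr : k ≤ r) (hn : k ≤ n)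
    {R : Matrix (Fin r) (Fin n) ℝ} (hR : ∀ (i : Fin r) (j : Fin n), j.val < i.val → R i j = 0)
    (w : Fin k → ℝ) : vecNorm (firstCols hn R *ᵥ w) = vecNorm (blockA hr hn R *ᵥ w) := by
  refine (vecNorm_comp_castLE hr fun i hi => ?_).symm
  rw [mulVec, dotProduct]
  refine Finset.sum_eq_zero fun l _ => ?_
  rw [firstCols, submatrix_apply, hR _ _ (by simp; omega), zero_mul]

/-- In the top `k` rows the difference is `B - A (A⁻¹ B) = 0`; in the lower rows the subtracted term
vanishes by triangularity, leaving `C_k`. -/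
lemma frobNorm_schur_eq_blockC {r n k : ℕ} (hr : k ≤ r) (hn : k ≤ n)
    {R : Matrix (Fin r) (Fin n) ℝ} (hR : ∀ (i : Fin r) (j : Fin n), j.val < i.val → R i j = 0)
    (hdet : IsUnit (blockA hr hn R).det) :
    frobNorm (lastCols k R - firstCols hn R * ((blockA hr hn R)⁻¹ * blockB hr R)) =
      frobNorm (blockC R k) := by
  refine (pow_left_inj₀ (frobNorm_nonneg _) (frobNorm_nonneg _) two_ne_zero).1 ?_
  rw [frobNorm_sq, frobNorm_sq]
  refine Finset.sum_congr rfl fun j _ => ?_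
  congr 1
  rw [← vecNorm_comp_val (k := k)]
  · congr 1
    ext i
    have : ((firstCols hn R * ((blockA hr hn R)⁻¹ * blockB hr R)) : Matrix _ _ ℝ) i.1 j = 0 := by
      rw [mul_apply]
      refine Finset.sum_eq_zero fun l _ => ?_
      have := i.2
      simp only [firstCols, submatrix_apply]
      rw [hR _ _ (by simp; omega), zero_mul]
    simp only [col_apply, Matrix.sub_apply, this, sub_zero]
    rfl
  · intro i hi
    have h1 : blockA hr hn R * ((blockA hr hn R)⁻¹ * blockB hr R) = blockB hr R := by
      rw [← Matrix.mul_assoc, mul_nonsing_inv _ hdet, Matrix.one_mul]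
    have h2 := congrFun (congrFun h1 ⟨i, hi⟩) j
    simp only [col_apply, Matrix.sub_apply, sub_eq_zero]
    exact h2.symm

/-! ### Error analysis -/

/-- Columnwise bounds for the residual `G * X - Q * R`. -/
lemma residual_col_bounds {m n d r : ℕ} {u η : ℝ} (hu0 : 0 ≤ u) (hu : u ≤ 1 / 1000)
    (hη : η ≤ 1 / 10) {X : Matrix (Fin m) (Fin n) ℝ} {G : Matrix (Fin d) (Fin m) ℝ}
    {Y : Matrix (Fin d) (Fin n) ℝ} {Q : Matrix (Fin d) (Fin r) ℝ} {R : Matrix (Fin r) (Fin n) ℝ}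
    (hG : ∀ x ∈ LinearMap.range X.mulVecLin,
      3 / 4 * vecNorm x ≤ vecNorm (G *ᵥ x) ∧ vecNorm (G *ᵥ x) ≤ 5 / 4 * vecNorm x)
    (hQ : frobNorm (Qᵀ * Q - 1) ≤ 1 / 10 * u) (j : Fin n)
    (hE1 : vecNorm ((G * X - Y).col j) ≤ η * u * vecNorm (X.col j))
    (hE2 : vecNorm ((Y - Q * R).col j) ≤ 1 / 100 * u * vecNorm (Y.col j)) :
    vecNorm ((G * X - Q * R).col j) ≤ (η + 13 / 1000) * u * vecNorm (X.col j) ∧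
      vecNorm (R.col j) ≤ 1251 / 1000 * vecNorm (X.col j) ∧
      vecNorm (X.col j) ≤ 67 / 50 * vecNorm (R.col j) := by
  have hx := hG (X.col j) ⟨Pi.single j 1, by simp⟩
  have hq := vecNorm_mulVec_bounds_of_almost_orthonormal (by linarith) hQ (R.col j)
  have e1 : Y.col j = G *ᵥ X.col j - (G * X - Y).col j := by
    rw [← col_mul]; ext; simp
  have e2 : (G * X - Q * R).col j = (G * X - Y).col j + (Y - Q * R).col j := by
    ext; simp
  have e3 : Q *ᵥ R.col j = G *ᵥ X.col j - (G * X - Q * R).col j := by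
    rw [← col_mul, ← col_mul]; ext; simp
  have e4 : G *ᵥ X.col j = Q *ᵥ R.col j + (G * X - Q * R).col j := by
    rw [e3]; abel
  have n1 := vecNorm_sub_le (G *ᵥ X.col j) ((G * X - Y).col j)
  have n2 := vecNorm_add_le ((G * X - Y).col j) ((Y - Q * R).col j)
  have n3 := vecNorm_sub_le (G *ᵥ X.col j) ((G * X - Q * R).col j)
  have n4 := vecNorm_add_le (Q *ᵥ R.col j) ((G * X - Q * R).col j)
  rw [← e1] at n1
  rw [← e2] at n2
  rw [← e3] at n3
  rw [← e4] at n4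
  set x := vecNorm (X.col j)
  set y := vecNorm (Y.col j)
  set z := vecNorm (R.col j)
  have hx0 : 0 ≤ x := vecNorm_nonneg _
  have hz0 : 0 ≤ z := vecNorm_nonneg _
  have hux : u * x ≤ 1 / 1000 * x := mul_le_mul_of_nonneg_right hu hx0
  have huz : u * z ≤ 1 / 1000 * z := mul_le_mul_of_nonneg_right hu hz0
  have hux0 : 0 ≤ u * x := mul_nonneg hu0 hx0
  have hηx : η * u * x ≤ 1 / 10 * (u * x) := by
    rw [mul_assoc]; exact mul_le_mul_of_nonneg_right hη hux0
  -- The constant 13/1000 in the first claim covers 1/100 · 63/50, the QR residual measured against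
  -- `X`.
  have hy : y ≤ 63 / 50 * x := by linarith
  have huy : u * y ≤ 63 / 50 * (u * x) := by nlinarith
  have hE : vecNorm ((G * X - Q * R).col j) ≤ (η + 13 / 1000) * u * x := by linarith
  refine ⟨hE, ?_, ?_⟩ <;> linarith

/-- Error analysis of the preconditioner for a sketch `G * X ≈ Y ≈ Q * R` with a well conditioned
leading block: `P` is well conditioned and `P * R[1..k, :]` reconstructs `X`. -/
lemma precond_error {m n d r k : ℕ} (hk : 1 ≤ k) (hr : k ≤ r) (hn : k ≤ n) {u : ℝ} (hu0 : 0 ≤ u)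
    (hu : u ≤ 1 / 1000) {X : Matrix (Fin m) (Fin n) ℝ} {G : Matrix (Fin d) (Fin m) ℝ}
    {Y : Matrix (Fin d) (Fin n) ℝ} {Q : Matrix (Fin d) (Fin r) ℝ} {R : Matrix (Fin r) (Fin n) ℝ}
    {P : Matrix (Fin m) (Fin k) ℝ}
    (hG : ∀ x ∈ LinearMap.range X.mulVecLin,
      3 / 4 * vecNorm x ≤ vecNorm (G *ᵥ x) ∧ vecNorm (G *ᵥ x) ≤ 5 / 4 * vecNorm x)
    (hQ : frobNorm (Qᵀ * Q - 1) ≤ 1 / 10 * u)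
    (hE1 : ∀ j, vecNorm ((G * X - Y).col j) ≤ 1 / 10 * u * vecNorm (X.col j))
    (hE1k : ∀ j : Fin n, j.val < k →
      vecNorm ((G * X - Y).col j) ≤ 1 / 100 * u * vecNorm (X.col j))
    (hE2 : ∀ j, vecNorm ((Y - Q * R).col j) ≤ 1 / 100 * u * vecNorm (Y.col j))
    (hR : ∀ (i : Fin r) (j : Fin n), j.val < i.val → R i j = 0)
    (hdet : IsUnit (blockA hr hn R).det)
    (hA : ∀ w, k * u * frobNorm (blockA hr hn R) * vecNorm w ≤
      1 / 250 * vecNorm (blockA hr hn R *ᵥ w))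
    (hAB : frobNorm ((blockA hr hn R)⁻¹ * blockB hr R) ≤ 2 * √n * √k)
    (hP : ∀ j, vecNorm ((firstCols hn X - P * blockA hr hn R).col j) ≤
      38 / 25 * (k * u) * (specNorm P * vecNorm ((blockA hr hn R).col j))) :
    (∀ w, 79 / 100 * vecNorm w ≤ vecNorm (P *ᵥ w)) ∧
    (∀ w, vecNorm (P *ᵥ w) ≤ 1343 / 1000 * vecNorm w) ∧
    frobNorm R ≤ 1251 / 1000 * frobNorm X ∧
    frobNorm (X - P * firstRows hr R) ≤
      1334 / 1000 * frobNorm (blockC R k) + 10 * n * k * u * frobNorm X := by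
  set A := blockA hr hn R with hAdef
  set B := blockB hr R with hBdef
  set Z := A⁻¹ * B with hZ
  set E := G * X - Q * R with hE
  set p := specNorm P with hp
  have hp0 : 0 ≤ p := specNorm_nonneg P
  have hk1 : (1 : ℝ) ≤ k := by exact_mod_cast hk
  have hkn : (k : ℝ) ≤ n := by exact_mod_cast hn
  have hcol := fun j => residual_col_bounds hu0 hu le_rfl hG hQ j (hE1 j) (hE2 j)
  have hQb := fun w => vecNorm_mulVec_bounds_of_almost_orthonormal (by linarith) hQ w
  set x := frobNorm X with hx
  have hx0 : 0 ≤ x := frobNorm_nonneg _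
  have hEx : frobNorm E ≤ 113 / 1000 * u * x := by
    refine frobNorm_le_of_col_le (by positivity) fun j => ?_
    refine (hcol j).1.trans_eq (by ring)
  have hRx : frobNorm R ≤ 1251 / 1000 * x :=
    frobNorm_le_of_col_le (by positivity) fun j => (hcol j).2.1
  have hAR : frobNorm A ≤ frobNorm R :=
    frobNorm_submatrix_le R (Fin.castLE_injective hr) (Fin.castLE_injective hn)
  set α := frobNorm A with hα
  have hα0 : 0 ≤ α := frobNorm_nonneg _
  -- On the leading columns the error is measured against `A` instead of `X`, so that `hA` can
  -- compare it with `A z`; (1/100 + 13/1000) · 67/50 is below 31/1000.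
  have hEk : frobNorm (firstCols hn E) ≤ 31 / 1000 * u * α := by
    refine frobNorm_le_of_col_le (by positivity) fun j => ?_
    have h := residual_col_bounds hu0 hu (by norm_num) hG hQ (Fin.castLE hn j)
      (hE1k _ (by simp)) (hE2 _)
    have h1 : vecNorm (R.col (Fin.castLE hn j)) = vecNorm (A.col j) := by
      have := vecNorm_firstCols_mulVec_of_upper hr hn hR (Pi.single j 1)
      rw [mulVec_single_one, mulVec_single_one] at this
      exact this
    rw [h1] at h
    have h2 : u * vecNorm (X.col (Fin.castLE hn j)) ≤ u * (67 / 50 * vecNorm (A.col j)) :=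
      mul_le_mul_of_nonneg_left h.2.2 hu0
    have h3 : 0 ≤ u * vecNorm (A.col j) := mul_nonneg hu0 (vecNorm_nonneg _)
    have h4 : vecNorm ((firstCols hn E).col j) ≤ _ := h.1
    linarith
  have huα : ∀ z, u * α * vecNorm z ≤ 1 / 250 * vecNorm (A *ᵥ z) := fun z => by
    refine le_trans ?_ (hA z)
    have : 0 ≤ u * α * vecNorm z := mul_nonneg (mul_nonneg hu0 hα0) (vecNorm_nonneg _)
    nlinarith
  -- the exact preconditioner
  have hXA : ∀ z, vecNorm (firstCols hn X *ᵥ z) ≤ 13338 / 10000 * vecNorm (A *ᵥ z) ∧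
      7997 / 10000 * vecNorm (A *ᵥ z) ≤ vecNorm (firstCols hn X *ᵥ z) := fun z => by
    have h1 := hG _ (firstCols_mulVec_mem_range hn X z)
    have h2 : G *ᵥ (firstCols hn X *ᵥ z) = Q *ᵥ (firstCols hn R *ᵥ z) + firstCols hn E *ᵥ z := by
      have : firstCols hn E = G * firstCols hn X - Q * firstCols hn R := rfl
      rw [this, sub_mulVec, mulVec_mulVec, mulVec_mulVec]
      abel
    have h3 : Q *ᵥ (firstCols hn R *ᵥ z) = G *ᵥ (firstCols hn X *ᵥ z) - firstCols hn E *ᵥ z := by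
      rw [h2]; abel
    have h4 := hQb (firstCols hn R *ᵥ z)
    rw [vecNorm_firstCols_mulVec_of_upper hr hn hR] at h4
    have h5 : vecNorm (firstCols hn E *ᵥ z) ≤ 1 / 5000 * vecNorm (A *ᵥ z) := by
      have a1 := vecNorm_mulVec_le (firstCols hn E) z
      have a2 := mul_le_mul_of_nonneg_right hEk (vecNorm_nonneg z)
      linarith [huα z, vecNorm_nonneg (A *ᵥ z)]
    have h6 := vecNorm_add_le (Q *ᵥ (firstCols hn R *ᵥ z)) (firstCols hn E *ᵥ z)
    have h7 := vecNorm_sub_le (G *ᵥ (firstCols hn X *ᵥ z)) (firstCols hn E *ᵥ z)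
    rw [← h2] at h6
    rw [← h3] at h7
    have h8 : u * vecNorm (A *ᵥ z) ≤ 1 / 1000 * vecNorm (A *ᵥ z) :=
      mul_le_mul_of_nonneg_right hu (vecNorm_nonneg _)
    have h9 := vecNorm_nonneg (A *ᵥ z)
    constructor <;> linarith
  -- the error of the substitution
  set V := firstCols hn X - P * A with hV
  have hVα : frobNorm V ≤ 38 / 25 * (k * u) * p * α :=
    frobNorm_le_of_col_le (by positivity) fun j => (hP j).trans_eq (by ring)
  have hVz : ∀ z, vecNorm (V *ᵥ z) ≤ 608 / 100000 * p * vecNorm (A *ᵥ z) := fun z => by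
    have a1 := vecNorm_mulVec_le V z
    have a2 := mul_le_mul_of_nonneg_right hVα (vecNorm_nonneg z)
    have a3 := mul_le_mul_of_nonneg_left (hA z) hp0
    linarith
  have hPA : ∀ z, P *ᵥ (A *ᵥ z) = firstCols hn X *ᵥ z - V *ᵥ z := fun z => by
    rw [hV, sub_mulVec, mulVec_mulVec]; abel
  have hXP : ∀ z, firstCols hn X *ᵥ z = P *ᵥ (A *ᵥ z) + V *ᵥ z := fun z => by
    rw [hPA]; abel
  have hsurj : ∀ w, ∃ z, A *ᵥ z = w := fun w =>
    ⟨A⁻¹ *ᵥ w, by rw [mulVec_mulVec, mul_nonsing_inv _ hdet, one_mulVec]⟩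
  -- `V` is bounded in terms of `p` itself: `p ≤ 1.3338 + 0.00608 p`, and the last term is absorbed.
  have hp1 : p ≤ 1343 / 1000 := by
    have : p ≤ 13338 / 10000 + 608 / 100000 * p := by
      refine specNorm_le_of_bound (by positivity) fun w => ?_
      obtain ⟨z, rfl⟩ := hsurj w
      rw [hPA]
      linarith [vecNorm_sub_le (firstCols hn X *ᵥ z) (V *ᵥ z), (hXA z).1, hVz z]
    linarith
  have hVx : frobNorm V ≤ 2555 / 1000 * (k * u * x) := by
    have a1 : p * α ≤ 1343 / 1000 * (1251 / 1000 * x) :=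
      mul_le_mul hp1 (hAR.trans hRx) hα0 (by norm_num)
    have a2 := mul_le_mul_of_nonneg_left a1 (by positivity : 0 ≤ (k : ℝ) * u)
    have a3 : 0 ≤ k * u * x := by positivity
    linarith
  refine ⟨fun w => ?_, fun w => ?_, hRx, ?_⟩
  · obtain ⟨z, rfl⟩ := hsurj w
    have h1 := vecNorm_add_le (P *ᵥ (A *ᵥ z)) (V *ᵥ z)
    rw [← hXP] at h1
    have h2 := mul_le_mul_of_nonneg_right hp1 (vecNorm_nonneg (A *ᵥ z))
    linarith [(hXA z).2, hVz z, vecNorm_nonneg (A *ᵥ z)]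
  · exact (vecNorm_mulVec_le_specNorm P w).trans (mul_le_mul_of_nonneg_right hp1 (vecNorm_nonneg w))
  -- the reconstruction error
  set W := lastCols k X - firstCols hn X * Z with hW
  set D := lastCols k R - firstCols hn R * Z with hD
  have hDC : frobNorm D = frobNorm (blockC R k) := frobNorm_schur_eq_blockC hr hn hR hdet
  set γ := frobNorm (blockC R k) with hγ
  have hγ0 : 0 ≤ γ := frobNorm_nonneg _
  set b := frobNorm Z with hb
  have hb0 : 0 ≤ b := frobNorm_nonneg _
  have hGW : frobNorm W ≤ 4 / 3 * frobNorm (G * W) := by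
    refine frobNorm_le_of_col_le (by norm_num) fun j => ?_
    have hmem : W.col j ∈ LinearMap.range X.mulVecLin := by
      have : W.col j = X *ᵥ Pi.single j.1 1 - firstCols hn X *ᵥ Z.col j := by
        rw [mulVec_single_one, ← col_mul]; rfl
      rw [this]
      exact Submodule.sub_mem _ ⟨_, rfl⟩ (firstCols_mulVec_mem_range hn X _)
    have := (hG _ hmem).1
    rw [col_mul]
    linarith
  have hGWle : frobNorm (G * W) ≤ (1 + 1 / 10 * u) * γ + 113 / 1000 * u * x * (1 + b) := by
    have h1 : G * W = Q * D + (lastCols k E - firstCols hn E * Z) := by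
      have e1 : firstCols hn E = G * firstCols hn X - Q * firstCols hn R := rfl
      have e2 : lastCols k E = G * lastCols k X - Q * lastCols k R := rfl
      rw [e1, e2, hW, hD, Matrix.mul_sub, Matrix.mul_sub, Matrix.sub_mul, Matrix.mul_assoc,
        Matrix.mul_assoc]
      abel
    have h2 : frobNorm (Q * D) ≤ (1 + 1 / 10 * u) * γ := by
      rw [← hDC]
      exact frobNorm_mul_le_of_bound (by positivity) (fun w => (hQb w).2) D
    have h3 : frobNorm (firstCols hn E * Z) ≤ 113 / 1000 * u * x * b :=
      (frobNorm_mul_le _ _).trans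
        (mul_le_mul_of_nonneg_right ((frobNorm_firstCols_le hn E).trans hEx) hb0)
    have h4 : frobNorm (lastCols k E) ≤ 113 / 1000 * u * x := (frobNorm_lastCols_le E).trans hEx
    rw [h1]
    linarith [frobNorm_add_le (Q * D) (lastCols k E - firstCols hn E * Z),
      frobNorm_sub_le (lastCols k E) (firstCols hn E * Z)]
  have hlast : lastCols k (X - P * firstRows hr R) = W + V * Z := by
    have e1 : lastCols k (X - P * firstRows hr R) = lastCols k X - P * B := rfl
    rw [e1, hW, hV, Matrix.sub_mul, Matrix.mul_assoc, hZ, ← Matrix.mul_assoc A,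
      mul_nonsing_inv _ hdet, Matrix.one_mul]
    abel
  have hfirst : firstCols hn (X - P * firstRows hr R) = V := rfl
  have htot := frobNorm_le_firstCols_add_lastCols hn (X - P * firstRows hr R)
  rw [hlast, hfirst] at htot
  have hVZ : frobNorm (V * Z) ≤ 2555 / 1000 * (k * u * x) * b :=
    (frobNorm_mul_le _ _).trans (mul_le_mul_of_nonneg_right hVx hb0)
  have hadd := frobNorm_add_le W (V * Z)
  have hb3 : 1 + b ≤ 3 * n := by
    have h1 : √(n : ℝ) * √k ≤ n := by
      calc √(n : ℝ) * √k ≤ √n * √n := by gcongr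
        _ = n := Real.mul_self_sqrt (by positivity)
    linarith
  have hux : 0 ≤ u * x := by positivity
  have hkux : u * x ≤ k * u * x := by nlinarith
  -- Here 151/1000 bounds 4/3 · 113/1000, and `k ≥ 1` merges the two terms. The result 3 · 2.706
  -- stays below the factor 10 of the claim.
  have hmain : (2555 / 1000 * (k * u * x) + 151 / 1000 * (u * x)) * (1 + b) ≤
      (2706 / 1000 * (k * u * x)) * (3 * n) :=
    mul_le_mul (by linarith) hb3 (by positivity) (by positivity)
  have huγ : u * γ ≤ 1 / 1000 * γ := mul_le_mul_of_nonneg_right hu hγ0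
  have hnk : 0 ≤ n * k * u * x := by positivity
  have huxb : 0 ≤ u * x * b := by positivity
  linarith

/-! ### From the hypotheses on a run to the error analysis; rescaling by `t` -/

lemma rpow_half_eq_sqrt_pow {x : ℝ} (hx : 0 ≤ x) (j : ℕ) : x ^ ((j : ℝ) / 2) = √x ^ j := by
  rw [Real.rpow_div_two_eq_sqrt _ hx, Real.rpow_natCast]

lemma rpow_neg_half_eq_sqrt_pow_inv {x : ℝ} (hx : 0 ≤ x) (j : ℕ) :
    x ^ (-((j : ℝ) / 2)) = (√x ^ j)⁻¹ := by
  rw [Real.rpow_neg hx, rpow_half_eq_sqrt_pow hx]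

lemma one_le_sqrt_natCast {n : ℕ} (hn : 1 ≤ n) : 1 ≤ √(n : ℝ) :=
  Real.one_le_sqrt.2 (by exact_mod_cast hn)

lemma specNorm_smul {ι κ : Type} [Fintype ι] [Fintype κ] [DecidableEq κ] (c : ℝ)
    (X : Matrix ι κ ℝ) : specNorm (c • X) = |c| * specNorm X := by
  simp [specNorm, norm_smul]

lemma frobNorm_permCols {ι : Type} [Fintype ι] {n : ℕ} (X : Matrix ι (Fin n) ℝ)
    (J : Equiv.Perm (Fin n)) : frobNorm (permCols X J) = frobNorm X := by
  rw [frobNorm, frobNorm]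
  congr 1
  exact Finset.sum_congr rfl fun i _ => Equiv.sum_comp J fun j => X i j ^ 2

lemma mem_range_of_mem_range_permCols {m n : ℕ} {M : Matrix (Fin m) (Fin n) ℝ}
    {J : Equiv.Perm (Fin n)} {x : Fin m → ℝ} (hx : x ∈ LinearMap.range (permCols M J).mulVecLin) :
    x ∈ LinearMap.range M.mulVecLin := by
  obtain ⟨w, rfl⟩ := hx
  refine ⟨w ∘ J.symm, ?_⟩
  have := submatrix_mulVec_equiv M w id J
  exact this.symm

lemma PrecondRun.mul_roundoff_le {m n d r k : ℕ} (hk : 1 ≤ k) {hr : k ≤ r} {hn : k ≤ n} {u : ℝ}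
    {M : Matrix (Fin m) (Fin n) ℝ} {Y : Matrix (Fin d) (Fin n) ℝ} {J : Equiv.Perm (Fin n)}
    {Q : Matrix (Fin d) (Fin r) ℝ} {R : Matrix (Fin r) (Fin n) ℝ} {P : Matrix (Fin m) (Fin k) ℝ}
    (h : PrecondRun hr hn u M Y J Q R P) : k * u ≤ 1 / 1000 := by
  have hule := h.roundoff_le
  have e1 := rpow_neg_half_eq_sqrt_pow_inv (Nat.cast_nonneg (α := ℝ) n) 3
  have e2 := rpow_neg_half_eq_sqrt_pow_inv (Nat.cast_nonneg (α := ℝ) k) 5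
  push_cast at e1 e2
  rw [e1, e2] at hule
  have ha := one_le_sqrt_natCast (hk.trans hn)
  have hb := one_le_sqrt_natCast hk
  have h1 : u ≤ 1 / 1000 * (√(k : ℝ) ^ 5)⁻¹ := by
    refine hule.trans (mul_le_mul_of_nonneg_right ?_ (by positivity))
    exact mul_le_of_le_one_right (by norm_num) (inv_le_one_of_one_le₀ (one_le_pow₀ ha))
  have h2 : (√(k : ℝ) ^ 5)⁻¹ ≤ (√(k : ℝ) ^ 2)⁻¹ :=
    inv_anti₀ (by positivity) (pow_le_pow_right₀ hb (by norm_num))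
  rw [Real.sq_sqrt (Nat.cast_nonneg k)] at h2
  have h3 : u ≤ 1 / 1000 * (k : ℝ)⁻¹ := by linarith
  calc k * u ≤ k * (1 / 1000 * (k : ℝ)⁻¹) := mul_le_mul_of_nonneg_left h3 (by positivity)
    _ = _ := by field_simp

/-- Conditioning of the leading block of the R-factor at an admissible truncation index. -/
lemma PrecondRun.leading_block {m n d r k : ℕ} (hk : 1 ≤ k) {hr : k ≤ r} {hn : k ≤ n} {u : ℝ}
    {M : Matrix (Fin m) (Fin n) ℝ} {Y : Matrix (Fin d) (Fin n) ℝ} {J : Equiv.Perm (Fin n)}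
    {Q : Matrix (Fin d) (Fin r) ℝ} {R : Matrix (Fin r) (Fin n) ℝ} {P : Matrix (Fin m) (Fin k) ℝ}
    (h : PrecondRun hr hn u M Y J Q R P) :
    0 < specNorm R ∧ IsUnit (blockA hr hn R).det ∧
      ∀ w, k * u * frobNorm (blockA hr hn R) * vecNorm w ≤
        1 / 250 * vecNorm (blockA hr hn R *ᵥ w) := by
  have hu := h.roundoff_pos
  have htr := h.truncation
  have hσA := h.rankRevealing.sigmaMin_blockA
  have hσC := h.rankRevealing.specNorm_blockC
  have e1 := rpow_half_eq_sqrt_pow (Nat.cast_nonneg (α := ℝ) n) 3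
  have e2 := rpow_half_eq_sqrt_pow (Nat.cast_nonneg (α := ℝ) k) 5
  have e3 := rpow_half_eq_sqrt_pow (Nat.cast_nonneg (α := ℝ) n) 1
  have e4 := rpow_half_eq_sqrt_pow (Nat.cast_nonneg (α := ℝ) k) 1
  have e5 := rpow_neg_half_eq_sqrt_pow_inv (Nat.cast_nonneg (α := ℝ) n) 1
  have e6 := rpow_neg_half_eq_sqrt_pow_inv (Nat.cast_nonneg (α := ℝ) k) 1
  push_cast at e1 e2 e3 e4 e5 e6
  rw [pow_one] at e3 e4 e5 e6
  rw [e1, e2] at htr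
  rw [e5, e6] at hσA
  rw [e3, e4] at hσC
  have ha := one_le_sqrt_natCast (hk.trans hn)
  have hb := one_le_sqrt_natCast hk
  have hb2 : √(k : ℝ) ^ 2 = k := Real.sq_sqrt (Nat.cast_nonneg k)
  have hcard : √(Fintype.card {j : Fin n // k - 1 ≤ (j : ℕ)} : ℝ) ≤ √(n : ℝ) := by
    refine Real.sqrt_le_sqrt ?_
    exact_mod_cast (Fintype.card_subtype_le _).trans_eq (Fintype.card_fin n)
  set a := √(n : ℝ)
  set b := √(k : ℝ)
  set σ := sigma Y k
  set ρ := specNorm R with hρ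
  set A := blockA hr hn R with hA
  have ha0 : 0 < a := by linarith
  have hb0 : 0 < b := by linarith
  -- If `‖R‖₂` were 0, the quotient in the truncation condition would be 0 by convention,
  -- contradicting its positive lower bound.
  have hρ0 : 0 < ρ := by
    refine (specNorm_nonneg R).lt_of_ne' fun h0 => ?_
    rw [hρ, h0, div_zero] at htr
    exact absurd htr (not_le.2 (by positivity))
  have hC : frobNorm (blockC R (k - 1)) ≤ a * (2 * a * b * σ) :=
    (frobNorm_le_sqrt_card_mul_specNorm _).trans
      (mul_le_mul hcard hσC (specNorm_nonneg _) ha0.le)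
  rw [le_div_iff₀ hρ0] at htr
  -- Truncation bounds `‖R‖₂` by `‖C_{k-1}‖_F`, which the rank-revealing property bounds by `σ_k`.
  -- In particular `σ_k > 0`, which makes `A` invertible.
  have hmain : 1000 * a ^ 3 * b ^ 5 * u * ρ ≤ 2 * a ^ 2 * b * σ := by
    calc _ ≤ _ := htr.trans hC
      _ = _ := by ring
  have hσ0 : 0 < σ := by
    have : 0 < 2 * a ^ 2 * b * σ := lt_of_lt_of_le (by positivity) hmain
    exact pos_of_mul_pos_right this (by positivity)
  have hAw : ∀ w, σ * vecNorm w ≤ 2 * a * b * vecNorm (A *ᵥ w) := fun w => by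
    have h1 := (mul_le_mul_of_nonneg_right hσA (vecNorm_nonneg w)).trans
      (sigmaMin_mul_vecNorm_le A w)
    calc σ * vecNorm w = 2 * a * b * (1 / 2 * a⁻¹ * b⁻¹ * σ * vecNorm w) := by field_simp
      _ ≤ _ := mul_le_mul_of_nonneg_left h1 (by positivity)
  have hAF : frobNorm A ≤ b * ρ := by
    have := frobNorm_le_sqrt_card_mul (specNorm_nonneg R) (X := A) fun j => ?_
    · rwa [Fintype.card_fin] at this
    · refine le_trans ?_ (vecNorm_col_le_specNorm R (Fin.castLE hn j))
      refine (vecNorm_comp_castLE hr (v := R.col (Fin.castLE hn j)) fun i hi => ?_).le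
      exact h.qrcp.upper _ _ (by simp; omega)
  refine ⟨hρ0, ?_, fun w => ?_⟩
  · rw [isUnit_iff_ne_zero]
    intro h0
    obtain ⟨w, hw, hw0⟩ := exists_mulVec_eq_zero_iff.2 h0
    have := hAw w
    rw [hw0, vecNorm_zero, mul_zero] at this
    exact hw (vecNorm_eq_zero (le_antisymm (nonpos_of_mul_nonpos_right this hσ0) (vecNorm_nonneg w)))
  · have hw0 := vecNorm_nonneg w
    have h1 : 1000 * a ^ 3 * b ^ 5 * u * ρ * vecNorm w ≤
        2 * a ^ 2 * b * (2 * a * b * vecNorm (A *ᵥ w)) := by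
      calc _ ≤ 2 * a ^ 2 * b * σ * vecNorm w := mul_le_mul_of_nonneg_right hmain hw0
        _ = 2 * a ^ 2 * b * (σ * vecNorm w) := by ring
        _ ≤ _ := mul_le_mul_of_nonneg_left (hAw w) (by positivity)
    -- Cancelling `1000 a³ b²` against `4 a³ b²` produces 1/250; the remaining `b³ = k √k` is
    -- exactly what `k ‖A‖_F ≤ k √k ‖R‖₂` requires.
    have h2 : b ^ 3 * u * ρ * vecNorm w ≤ 1 / 250 * vecNorm (A *ᵥ w) := by
      refine le_of_mul_le_mul_left (a := 1000 * a ^ 3 * b ^ 2) ?_ (by positivity)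
      calc _ = 1000 * a ^ 3 * b ^ 5 * u * ρ * vecNorm w := by ring
        _ ≤ _ := h1
        _ = _ := by ring
    refine le_trans ?_ h2
    calc k * u * frobNorm A * vecNorm w ≤ k * u * (b * ρ) * vecNorm w := by gcongr
      _ = b ^ 3 * u * ρ * vecNorm w := by rw [← hb2]; ring

/-- Stability of the preconditioner for an accurate sketch. -/
theorem precondStable_of_sketchAccurate {m n d r k : ℕ} (hk : 1 ≤ k) (hr : k ≤ r) (hn : k ≤ n)
    {u t δ : ℝ} {M : Matrix (Fin m) (Fin n) ℝ} {S : Matrix (Fin d) (Fin m) ℝ}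
    {Y : Matrix (Fin d) (Fin n) ℝ} {J : Equiv.Perm (Fin n)} {Q : Matrix (Fin d) (Fin r) ℝ}
    {R : Matrix (Fin r) (Fin n) ℝ} {P : Matrix (Fin m) (Fin k) ℝ} (ht : t ≠ 0) (hδ : δ ≤ 1 / 4)
    (hS : IsEmbedding δ (t • S) (LinearMap.range M.mulVecLin))
    (hY : SketchAccurate k u t S M Y J) (h : PrecondRun hr hn u M Y J Q R P) :
    PrecondStable hr u M J R P := by
  have hu0 := h.roundoff_pos
  have hAB := h.rankRevealing.frobNorm_blockB
  have hres := h.qrcp.residual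
  obtain ⟨hρ0, hdet, hA⟩ := h.leading_block hk
  have e3 := rpow_half_eq_sqrt_pow (Nat.cast_nonneg (α := ℝ) n) 1
  have e4 := rpow_half_eq_sqrt_pow (Nat.cast_nonneg (α := ℝ) k) 1
  have e5 := rpow_neg_half_eq_sqrt_pow_inv (Nat.cast_nonneg (α := ℝ) n) 1
  have e6 := rpow_neg_half_eq_sqrt_pow_inv (Nat.cast_nonneg (α := ℝ) k) 1
  push_cast at e3 e4 e5 e6
  rw [pow_one] at e3 e4 e5 e6
  have ha := one_le_sqrt_natCast (hk.trans hn)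
  have hb := one_le_sqrt_natCast hk
  have hk1 : (1 : ℝ) ≤ k := by exact_mod_cast hk
  rw [e3, e4] at hAB
  have ha1 : (√(n : ℝ))⁻¹ ≤ 1 := inv_le_one_of_one_le₀ ha
  have hb1 : (√(k : ℝ))⁻¹ ≤ 1 := inv_le_one_of_one_le₀ hb
  have huk := h.mul_roundoff_le hk
  have hu : u ≤ 1 / 1000 := (le_mul_of_one_le_left hu0.le hk1).trans huk
  have hcol : ∀ c e y : ℝ, 0 ≤ c → 0 ≤ y → e ≤ 1 → c * e * u * y ≤ c * u * y :=
    fun c e y hc hy he => by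
      refine mul_le_mul_of_nonneg_right (mul_le_mul_of_nonneg_right ?_ hu0.le) hy
      exact mul_le_of_le_one_right hc he
  have ht0 : 0 < |t| := abs_pos.2 ht
  -- The bound `‖P‖₂` is written as `‖t⁻¹ P‖₂ |t|` so that the substitution estimate matches the
  -- rescaled pair `t⁻¹ • P`, `t • A`.
  have hP0 : ∀ w, vecNorm (P *ᵥ w) ≤ specNorm (t⁻¹ • P) * |t| * vecNorm w := fun w => by
    rw [specNorm_smul, abs_inv, mul_comm |t|⁻¹, mul_assoc, mul_assoc, inv_mul_cancel_left₀ ht0.ne']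
    exact vecNorm_mulVec_le_specNorm P w
  have hupper : ∀ i j : Fin k, j < i → blockA hr hn R i j = 0 := fun i j hij =>
    h.qrcp.upper _ _ hij
  have hdiag : ∀ j, blockA hr hn R j j ≠ 0 := by
    have : (blockA hr hn R).det ≠ 0 := hdet.ne_zero
    rw [det_of_isUpperTriangular fun i j hij => hupper i j hij, Finset.prod_ne_zero_iff] at this
    exact fun j => this j (Finset.mem_univ j)
  have hblockA : blockA hr hn (t • R) = t • blockA hr hn R := rfl
  have hdet' : IsUnit (blockA hr hn (t • R)).det := by
    rw [hblockA, det_smul]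
    exact ((isUnit_iff_ne_zero.2 ht).pow _).mul hdet
  have hscale : ∀ l, (t⁻¹ • P) * (t • (l : Matrix (Fin k) (Fin k) ℝ)) = P * l := fun l => by
    rw [Matrix.smul_mul, Matrix.mul_smul, inv_smul_smul₀ ht]
  obtain ⟨hlo, hup, hRX, hrec⟩ := precond_error hk hr hn hu0.le hu (X := permCols M J) (G := t • S)
    (Y := t • permCols Y J) (Q := Q) (R := t • R) (P := t⁻¹ • P)
    (fun x hx => by
      have h1 := hS.bounds (mem_range_of_mem_range_permCols hx)
      have hx0 := vecNorm_nonneg x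
      constructor <;> nlinarith)
    h.qrcp.orth
    (fun j => by
      rcases lt_or_ge j.val k with hj | hj
      · refine ((hY j).1 hj).trans ?_
        rw [e6]
        refine (hcol _ _ _ (by norm_num) (vecNorm_nonneg _) hb1).trans ?_
        have := mul_nonneg hu0.le (vecNorm_nonneg ((permCols M J).col j))
        linarith
      · refine ((hY j).2 hj).trans ?_
        rw [e5]
        exact hcol _ _ _ (by norm_num) (vecNorm_nonneg _) ha1)
    (fun j hj => by
      refine ((hY j).1 hj).trans ?_
      rw [e6]
      exact hcol _ _ _ (by norm_num) (vecNorm_nonneg _) hb1)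
    (fun j => by
      have h1 := hres j
      rw [e6] at h1
      replace h1 := h1.trans (hcol _ _ _ (by norm_num) (vecNorm_nonneg _) hb1)
      have h2 : (t • permCols Y J - Q * (t • R)).col j = t • (permCols Y J - Q * R).col j := by
        rw [Matrix.mul_smul, ← smul_sub]; rfl
      have h3 : (t • permCols Y J).col j = t • (permCols Y J).col j := rfl
      rw [h2, h3, vecNorm_smul, vecNorm_smul, mul_left_comm]
      exact mul_le_mul_of_nonneg_left h1 ht0.le)
    (fun i j hij => by simp [h.qrcp.upper i j hij])
    hdet'
    (fun w => by
      rw [hblockA, frobNorm_smul, smul_mulVec, vecNorm_smul]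
      have := mul_le_mul_of_nonneg_left (hA w) ht0.le
      linarith)
    (by
      have hblockB : blockB hr (t • R) = t • blockB hr R := rfl
      have : Invertible t := invertibleOfNonzero ht
      rw [hblockA, hblockB, inv_smul _ _ hdet, Matrix.smul_mul, Matrix.mul_smul,
        smul_smul, invOf_mul_self, one_smul]
      exact hAB)
    (fun j => by
      have h1 := h.trsm.vecNorm_col_le hu0.le huk hupper hdiag
        (mul_nonneg (specNorm_nonneg _) ht0.le) hP0 j
      have h2 : (blockA hr hn (t • R)).col j = t • (blockA hr hn R).col j := rfl
      rw [h2, vecNorm_smul, hblockA, hscale, ← mul_assoc (specNorm _)]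
      exact h1)
  have hC : blockC (t • R) k = t • blockC R k := rfl
  have hPR : (t⁻¹ • P) * firstRows hr (t • R) = P * firstRows hr R := by
    have : firstRows hr (t • R) = t • firstRows hr R := rfl
    rw [this, Matrix.smul_mul, Matrix.mul_smul, inv_smul_smul₀ ht]
  have hPw : ∀ w, vecNorm (P *ᵥ w) = |t| * vecNorm ((t⁻¹ • P) *ᵥ w) := fun w => by
    rw [smul_mulVec, vecNorm_smul, abs_inv, mul_inv_cancel_left₀ ht0.ne']
  rw [frobNorm_smul, frobNorm_permCols] at hRX
  rw [hC, frobNorm_smul, hPR, frobNorm_permCols] at hrec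
  have hρF := specNorm_le_frobNorm R
  -- `M ≠ 0` because `R ≠ 0`, so the relative error is a genuine quotient.
  have hx0 : 0 < frobNorm M := by
    have : 0 < |t| * frobNorm R := mul_pos ht0 (hρ0.trans_le hρF)
    linarith
  refine ⟨?_, ?_⟩
  · have hγ0 : 0 ≤ frobNorm (blockC R k) := frobNorm_nonneg _
    have htρ : |t| * specNorm R ≤ 1251 / 1000 * frobNorm M :=
      (mul_le_mul_of_nonneg_left hρF ht0.le).trans hRX
    rw [div_le_iff₀ hx0, add_mul]
    refine hrec.trans (add_le_add_left ?_ _)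
    -- This trades `|t|` for `‖M‖_F / ‖R‖₂`; the constant 2 of the claim covers 1.334 · 1.251.
    have h1 : |t| ≤ 1251 / 1000 * frobNorm M / specNorm R := (le_div_iff₀ hρ0).2 htρ
    calc 1334 / 1000 * (|t| * frobNorm (blockC R k))
        ≤ 1334 / 1000 * (1251 / 1000 * frobNorm M / specNorm R * frobNorm (blockC R k)) := by gcongr
      _ = 1334 / 1000 * (1251 / 1000) * (frobNorm (blockC R k) / specNorm R * frobNorm M) := by ring
      _ ≤ 2 * (frobNorm (blockC R k) / specNorm R * frobNorm M) :=
        mul_le_mul_of_nonneg_right (by norm_num) (by positivity)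
      _ = _ := by ring
  · have := cond_le_of_bounds hk (X := P) (a := 79 / 100 * |t|) (b := 1343 / 1000 * |t|)
      (by positivity)
      (fun w => by
        rw [hPw]
        have := mul_le_mul_of_nonneg_left (hlo w) ht0.le
        linarith)
      (fun w => by
        rw [hPw]
        have := mul_le_mul_of_nonneg_left (hup w) ht0.le
        linarith)
    refine ⟨this.1, this.2.trans ?_⟩
    -- The factor `|t|` cancels, and 1.343 / 0.79 = 1.7.
    rw [mul_div_mul_right _ _ ht0.ne']
    norm_num

/-! ### Accuracy of a computed product -/

/-- Each entry involves `m` rounded products and `m - 1` additions. All partial sums of the rounded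
products are at most `(1 + u)` times the sum of the exact absolute values, and the two kinds of
error combine to the exponent `m`. -/
lemma FlMul.abs_sub_le {m n d : ℕ} {u : ℝ} (hu : 0 ≤ u) {S : Matrix (Fin d) (Fin m) ℝ}
    {M : Matrix (Fin m) (Fin n) ℝ} {Y : Matrix (Fin d) (Fin n) ℝ} (h : FlMul u S M Y)
    (i : Fin d) (j : Fin n) :
    |(S * M - Y) i j| ≤ ((1 + u) ^ m - 1) * ∑ l, |S i l * M l j| := by
  obtain ⟨T, q, hT, hq, hE⟩ := h i j
  set B := ∑ l, |S i l * M l j| with hB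
  have hm : 1 ≤ m := by
    have := T.card_leaves_pos
    rwa [hT, Finset.card_val, Finset.card_univ, Fintype.card_fin] at this
  have hunit : ∀ v : Unit → ℝ, vecNorm v = |v ()| := fun v => by
    rw [vecNorm_eq_sqrt, Fintype.sum_unique, Real.sqrt_sq_eq_abs]
  -- A single entry is treated as a vector with one coordinate, since here the order may differ from
  -- entry to entry.
  have h1 := SumTree.vecNorm_error_le_of_univ (κ := Unit) hu (fun _ => q) hT (fun _ => Y i j)
    (B := (1 + u) * B) (fun L => by
      rw [hunit]
      refine (Finset.abs_sum_le_sum_abs _ _).trans ?_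
      refine (Finset.sum_le_univ_sum_of_nonneg fun l => abs_nonneg _).trans ?_
      rw [hB, Finset.mul_sum]
      refine Finset.sum_le_sum fun l _ => ?_
      have := abs_add_le (q l - S i l * M l j) (S i l * M l j)
      rw [sub_add_cancel] at this
      linarith [(hq l).abs_sub_le]) fun _ => hE
  rw [hunit, Fintype.card_fin] at h1
  have h2 : |∑ l, q l - (S * M) i j| ≤ u * B := by
    rw [mul_apply, ← Finset.sum_sub_distrib, hB, Finset.mul_sum]
    exact (Finset.abs_sum_le_sum_abs _ _).trans (Finset.sum_le_sum fun l _ => (hq l).abs_sub_le)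
  have h3 := _root_.abs_sub_le (Y i j) (∑ l, q l) ((S * M) i j)
  rw [Matrix.sub_apply, abs_sub_comm]
  obtain ⟨N, rfl⟩ := Nat.exists_eq_add_of_le hm
  rw [Nat.add_sub_cancel_left] at h1
  calc _ ≤ ((1 + u) ^ N - 1) * ((1 + u) * B) + u * B := by linarith
    _ = _ := by ring

/-- The entrywise bound involves `|S| |M_j|`; taking absolute values leaves the Frobenius norm of
`S` unchanged, which is why that norm appears. -/
lemma FlMul.vecNorm_col_le {m n d : ℕ} {u : ℝ} (hu : 0 ≤ u) {S : Matrix (Fin d) (Fin m) ℝ}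
    {M : Matrix (Fin m) (Fin n) ℝ} {Y : Matrix (Fin d) (Fin n) ℝ} (h : FlMul u S M Y) (j : Fin n) :
    vecNorm ((S * M - Y).col j) ≤ ((1 + u) ^ m - 1) * (frobNorm S * vecNorm (M.col j)) := by
  have hγ : 0 ≤ (1 + u) ^ m - 1 := sub_nonneg.2 (one_le_pow₀ (by linarith))
  have h1 : vecNorm ((S * M - Y).col j) ≤
      ((1 + u) ^ m - 1) * vecNorm (S.map abs *ᵥ fun l => |M l j|) := by
    refine vecNorm_le_mul_of_abs_le hγ fun i => ?_
    refine (h.abs_sub_le hu i j).trans (mul_le_mul_of_nonneg_left ?_ hγ)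
    refine le_trans (le_of_eq ?_) (le_abs_self _)
    simp [mulVec, dotProduct, abs_mul]
  refine h1.trans (mul_le_mul_of_nonneg_left ((vecNorm_mulVec_le _ _).trans_eq ?_) hγ)
  rw [frobNorm, frobNorm, vecNorm_eq_sqrt, vecNorm_eq_sqrt]
  simp

lemma FlMul.sketchAccurate {m n d k : ℕ} (hk : 1 ≤ k) (hn : k ≤ n) {c u u' t : ℝ} (hu0 : 0 ≤ u)
    (hu : u ≤ 1 / 1000) {S : Matrix (Fin d) (Fin m) ℝ} {M : Matrix (Fin m) (Fin n) ℝ}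
    {Y : Matrix (Fin d) (Fin n) ℝ} (J : Equiv.Perm (Fin n)) (hS : |t| * frobNorm S ≤ c * √(m : ℝ))
    (hu'0 : 0 ≤ u')
    (hu' : u' ≤ (m : ℝ) ^ (-(3 / 2) : ℝ) * (200 * (|c| + 1) * n)⁻¹ * u) (h : FlMul u' S M Y) :
    SketchAccurate k u t S M Y J := by
  have hn1 : (1 : ℝ) ≤ n := by exact_mod_cast hk.trans hn
  have hb := one_le_sqrt_natCast hk
  have hkn : √(k : ℝ) ≤ √n := Real.sqrt_le_sqrt (by exact_mod_cast hn)
  have hsn : √(n : ℝ) ≤ n := Real.sqrt_le_iff.2 ⟨by linarith, by nlinarith⟩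
  have e1 := rpow_neg_half_eq_sqrt_pow_inv (Nat.cast_nonneg (α := ℝ) m) 3
  have e5 := rpow_neg_half_eq_sqrt_pow_inv (Nat.cast_nonneg (α := ℝ) n) 1
  have e6 := rpow_neg_half_eq_sqrt_pow_inv (Nat.cast_nonneg (α := ℝ) k) 1
  push_cast at e1 e5 e6
  rw [pow_one] at e5 e6
  rw [e1] at hu'
  set C := 200 * (|c| + 1) with hC
  have hC0 : 200 ≤ C := by linarith [abs_nonneg c]
  set g := √(m : ℝ) with hg
  have hg0 : 0 ≤ g := Real.sqrt_nonneg _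
  have hg2 : g ^ 2 = m := Real.sq_sqrt (Nat.cast_nonneg m)
  have hCn : (0 : ℝ) < C * n := by positivity
  have hmg : m * u' * g ≤ (C * n)⁻¹ * u := by
    -- Only an inequality, so that `m = 0` is included, where the inverse is 0.
    have h1 : g ^ 3 * (g ^ 3)⁻¹ ≤ 1 := mul_inv_le_one
    calc m * u' * g = g ^ 3 * u' := by rw [← hg2]; ring
      _ ≤ g ^ 3 * ((g ^ 3)⁻¹ * (C * n)⁻¹ * u) := mul_le_mul_of_nonneg_left hu' (by positivity)
      _ = g ^ 3 * (g ^ 3)⁻¹ * ((C * n)⁻¹ * u) := by ring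
      _ ≤ _ := mul_le_of_le_one_left (by positivity) h1
  have hm : m * u' ≤ 1 / 1000 := by
    rcases Nat.eq_zero_or_pos m with rfl | hm
    · simp
    · have h1 := one_le_sqrt_natCast hm
      have h2 : (C * n)⁻¹ * u ≤ u := mul_le_of_le_one_left hu0 (inv_le_one_of_one_le₀ (by nlinarith))
      have h3 : m * u' ≤ m * u' * g := le_mul_of_one_le_right (by positivity) h1
      linarith
  -- A bound with `n⁻¹` serves both ranges of columns, since `√k ≤ √n ≤ n`; this is why a linear `F`
  -- suffices.
  have key : ∀ j, vecNorm (((t • S) * permCols M J - t • permCols Y J).col j) ≤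
      1 / 100 * (n : ℝ)⁻¹ * u * vecNorm ((permCols M J).col j) := fun j => by
    have h1 : ((t • S) * permCols M J - t • permCols Y J).col j = t • (S * M - Y).col (J j) := by
      rw [Matrix.smul_mul, ← smul_sub]
      rfl
    rw [h1, vecNorm_smul]
    have h2 : (permCols M J).col j = M.col (J j) := rfl
    rw [h2]
    set y := vecNorm (M.col (J j))
    have hy : 0 ≤ y := vecNorm_nonneg _
    have hγ := one_add_pow_sub_one_le hu'0 hm
    have hmu0 : 0 ≤ m * u' := by positivity
    have hSc : |t| * frobNorm S ≤ |c| * g := hS.trans (mul_le_mul_of_nonneg_right (le_abs_self c) hg0)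
    have hfin : 1001 / 1000 * (|c| * (C * n)⁻¹) ≤ 1 / 100 * (n : ℝ)⁻¹ := by
      rw [mul_inv, ← mul_assoc, ← mul_assoc]
      refine mul_le_mul_of_nonneg_right ?_ (by positivity)
      rw [← div_eq_mul_inv, div_le_iff₀ (by linarith)]
      linarith [abs_nonneg c]
    calc |t| * vecNorm ((S * M - Y).col (J j))
        ≤ |t| * (((1 + u') ^ m - 1) * (frobNorm S * y)) :=
          mul_le_mul_of_nonneg_left (h.vecNorm_col_le hu'0 (J j)) (abs_nonneg t)
      _ = ((1 + u') ^ m - 1) * (|t| * frobNorm S * y) := by ring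
      _ ≤ 1001 / 1000 * (m * u') * (|c| * g * y) :=
          mul_le_mul hγ (mul_le_mul_of_nonneg_right hSc hy)
            (mul_nonneg (mul_nonneg (abs_nonneg t) (frobNorm_nonneg S)) hy) (by positivity)
      _ = 1001 / 1000 * |c| * (m * u' * g) * y := by ring
      _ ≤ 1001 / 1000 * |c| * ((C * n)⁻¹ * u) * y := by gcongr
      _ = 1001 / 1000 * (|c| * (C * n)⁻¹) * u * y := by ring
      _ ≤ _ := by gcongr
  refine fun j => ⟨fun _ => (key j).trans ?_, fun _ => (key j).trans ?_⟩
  · rw [e6]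
    have : (n : ℝ)⁻¹ ≤ (√(k : ℝ))⁻¹ := inv_anti₀ (by linarith) (hkn.trans hsn)
    have := vecNorm_nonneg ((permCols M J).col j)
    gcongr
  · rw [e5]
    have : (n : ℝ)⁻¹ ≤ (√(n : ℝ))⁻¹ := inv_anti₀ (by linarith) hsn
    have := vecNorm_nonneg ((permCols M J).col j)
    gcongr
    norm_num

end CQRRPT

end

/-! ### The two claims -/

theorem mainTheorem9 :
    (∀ {m n d r k : ℕ} (_ : 1 ≤ k) (hr : k ≤ r) (hn : k ≤ n) (u t δ : ℝ)
        (M : Matrix (Fin m) (Fin n) ℝ) (S : Matrix (Fin d) (Fin m) ℝ)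
        (Y : Matrix (Fin d) (Fin n) ℝ) (J : Equiv.Perm (Fin n))
        (Q : Matrix (Fin d) (Fin r) ℝ) (R : Matrix (Fin r) (Fin n) ℝ)
        (P : Matrix (Fin m) (Fin k) ℝ),
        t ≠ 0 → δ ≤ 1 / 4 →
        CQRRPT.IsEmbedding δ (t • S) (LinearMap.range M.mulVecLin) →
        CQRRPT.SketchAccurate k u t S M Y J →
        CQRRPT.PrecondRun hr hn u M Y J Q R P →
        CQRRPT.PrecondStable hr u M J R P) ∧
    (∀ c : ℝ, ∃ F : Polynomial ℝ, F.natDegree ≤ 1 ∧ (∀ x : ℝ, 1 ≤ x → 0 < F.eval x) ∧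
      ∀ {m n d r k : ℕ} (_ : 1 ≤ k) (hr : k ≤ r) (hn : k ≤ n) (u u' t δ : ℝ)
        (M : Matrix (Fin m) (Fin n) ℝ) (S : Matrix (Fin d) (Fin m) ℝ)
        (Y : Matrix (Fin d) (Fin n) ℝ) (J : Equiv.Perm (Fin n))
        (Q : Matrix (Fin d) (Fin r) ℝ) (R : Matrix (Fin r) (Fin n) ℝ)
        (P : Matrix (Fin m) (Fin k) ℝ),
        t ≠ 0 → δ ≤ 1 / 4 →
        CQRRPT.IsEmbedding δ (t • S) (LinearMap.range M.mulVecLin) →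
        |t| * CQRRPT.frobNorm S ≤ c * √(m : ℝ) →
        0 ≤ u' → u' ≤ (m : ℝ) ^ (-(3 / 2) : ℝ) * (F.eval (n : ℝ))⁻¹ * u →
        CQRRPT.FlMul u' S M Y →
        CQRRPT.PrecondRun hr hn u M Y J Q R P →
        CQRRPT.PrecondStable hr u M J R P) := by
  -- The witness is `F(x) = 200 (|c| + 1) x`: the 200 makes `1.001 |c| / (200 (|c| + 1))` at most
  -- 1/100, and `|c| + 1` keeps `F` positive for every `c`.
  refine ⟨?_, fun c => ⟨C (200 * (|c| + 1)) * X, ?_, fun x hx => ?_, ?_⟩⟩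
  · intro m n d r k hk hr hn u t δ M S Y J Q R P ht hδ hS hY h
    exact CQRRPT.precondStable_of_sketchAccurate hk hr hn ht hδ hS hY h
  · exact (natDegree_C_mul_le _ _).trans natDegree_X_le
  · rw [eval_mul, eval_C, eval_X]
    positivity
  · intro m n d r k hk hr hn u u' t δ M S Y J Q R P ht hδ hS hSm hu'0 hu' hY h
    rw [eval_mul, eval_C, eval_X] at hu'
    have hk1 : (1 : ℝ) ≤ k := by exact_mod_cast hk
    have hu0 := h.roundoff_pos.le
    exact CQRRPT.precondStable_of_sketchAccurate hk hr hn ht hδ hS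
      (hY.sketchAccurate hk hn hu0 ((le_mul_of_one_le_left hu0 hk1).trans (h.mul_roundoff_le hk))
        J hSm hu'0 hu') h
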